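/- Let $\Sigma$ be a totally ordered alphabet, and order strings over $\Sigma$ lexicographically (a proper prefix of a string is smaller than the string). A nonempty string $S$ is a Lyndon word if it is smaller than each of its nonempty proper suffixes. A longest Lyndon subsequence of a string $T$ is a subsequence of $T$ that is a Lyndon word and has the maximum length among all subsequences of $T$ that are Lyndon words. Theorem. Consider the word RAM with words of $w$ bits and unit-cost operations, whose input string $T$ of length $n$ is read-only and whose symbols are accessed by unit-cost comparisons of the symbols at two positions of $T$. There is an algorithm that, given any nonempty string $T$ of length $n$ over any totally ordered alphabet, computes a longest Lyndon subsequence of $T$ in $O(n^3)$ time using $O(n)$ words of space, namely the lexicographically smallest among all longest Lyndon subsequences of $T$, output as an increasing sequence of positions of $T$ that spells it. More precisely, there are a program and a constant $C$ such that for all such alphabets, strings and all $w$ with $2^w \ge C n$, the program halts with this output after at most $C n^3$ steps using a working memory of $C n$ words (besides a constant number of registers). -/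

import Mathlib

/-! ### Lyndon words and longest Lyndon subsequences

Strings are lists over a linearly ordered alphabet, `<` on lists is the lexicographic order
(a proper prefix is smaller), and `S.Sublist T` says that `S` is a subsequence of `T`. -/

/-- A Lyndon word: a nonempty string that is smaller than all its nonempty proper suffixes. -/
def IsLyndon {α : Type*} [LinearOrder α] (S : List α) : Prop :=
  S ≠ [] ∧ ∀ V : List α, V <:+ S → V ≠ [] → V ≠ S → S < V

/-- `S` is a longest Lyndon subsequence of `T`. -/
def IsLongestLyndonSubseq {α : Type*} [LinearOrder α] (T S : List α) : Prop :=
  S.Sublist T ∧ IsLyndon S ∧ ∀ S' : List α, S'.Sublist T → IsLyndon S' → S'.length ≤ S.length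

/-- `S` is the lexicographically smallest among all longest Lyndon subsequences of `T`. -/
def IsLeastLongestLyndonSubseq {α : Type*} [LinearOrder α] (T S : List α) : Prop :=
  IsLongestLyndonSubseq T S ∧ ∀ S' : List α, IsLongestLyndonSubseq T S' → S ≤ S'

/-- The (0-based) positions `I` are strictly increasing positions of `T`, and reading `T` at them
spells `S`. -/
def Spells {α : Type*} (T : List α) (I : List ℕ) (S : List α) : Prop :=
  I.Pairwise (· < ·) ∧ I.map (fun i => T[i]?) = S.map some

/-! ### A word RAM with unit-cost operations

Words have `w` bits. A program is a fixed finite text, so it uses a constant number of registers;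
besides these it has a random-access memory of `M` words. The input string `T` is read-only and,
as its alphabet is an arbitrary ordered set, its symbols are accessible only through comparisons
of the symbols at two positions. Control flow is structured (sequence, conditional, loop), which is
a special case of a RAM with jumps. -/

namespace WordRAM

/-- Arithmetic and bitwise operations on words. -/
inductive BinOp where
  | add | sub | mul | div | mod | and | or | xor | shl | shr

/-- All operations are on unsigned words and modulo `2 ^ w`. -/
def BinOp.eval {w : ℕ} : BinOp → BitVec w → BitVec w → BitVec w
  | .add, x, y => x + y
  | .sub, x, y => x - y
  | .mul, x, y => x * y
  | .div, x, y => x / y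
  | .mod, x, y => x % y
  | .and, x, y => x &&& y
  | .or, x, y => x ||| y
  | .xor, x, y => x ^^^ y
  | .shl, x, y => x <<< y
  | .shr, x, y => x >>> y

/-- Tests; the arguments are register numbers. -/
inductive Test where
  /-- the word in register `a` is smaller than that in register `b` -/
  | lt (a b : ℕ)
  /-- the words in registers `a` and `b` are equal -/
  | eq (a b : ℕ)
  /-- the input symbol at the position in register `a` is smaller than the one at the position
  in register `b` -/
  | symLt (a b : ℕ)

/-- Programs; `d`, `a`, `b` are register numbers. -/
inductive Prog where
  | skip
  /-- put the constant `k` into register `d` -/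
  | const (d k : ℕ)
  /-- put the result of `o` on registers `a` and `b` into register `d` -/
  | op (o : BinOp) (d a b : ℕ)
  /-- put the memory cell whose address is in register `a` into register `d` -/
  | load (d a : ℕ)
  /-- put register `b` into the memory cell whose address is in register `a` -/
  | store (a b : ℕ)
  | seq (P Q : Prog)
  /-- if `c` then `P` else `Q` -/
  | cond (c : Test) (P Q : Prog)
  /-- while `c` do `P` -/
  | loop (c : Test) (P : Prog)

/-- Contents of the registers and of the memory (only addresses below the memory size are ever
accessed, see `Exec`). -/
structure State (w : ℕ) where
  reg : ℕ → BitVec w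
  mem : ℕ → BitVec w

/-- Result of a test; `none` if it refers to a position outside the input string `T`. -/
def Test.eval {α : Type*} [LinearOrder α] (T : List α) {w : ℕ} (s : State w) : Test → Option Bool
  | .lt a b => some (decide ((s.reg a).toNat < (s.reg b).toNat))
  | .eq a b => some (decide (s.reg a = s.reg b))
  | .symLt a b =>
      match T[(s.reg a).toNat]?, T[(s.reg b).toNat]? with
      | some x, some y => some (decide (x < y))
      | _, _ => none

/-- `Exec T M P s t s'`: on the input string `T` and with a memory of `M` words, program `P`
started in state `s` halts in state `s'` after exactly `t` steps. Every instruction and every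
evaluation of a test costs one step. There is no rule for an access to a memory cell with an
address `≥ M` or to a position outside `T`: then the program has no halting run. -/
inductive Exec {α : Type*} [LinearOrder α] (T : List α) (M : ℕ) {w : ℕ} :
    Prog → State w → ℕ → State w → Prop
  | skip (s : State w) : Exec T M .skip s 1 s
  | const (d k : ℕ) (s : State w) :
      Exec T M (.const d k) s 1 { s with reg := Function.update s.reg d (BitVec.ofNat w k) }
  | op (o : BinOp) (d a b : ℕ) (s : State w) :
      Exec T M (.op o d a b) s 1
        { s with reg := Function.update s.reg d (o.eval (s.reg a) (s.reg b)) }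
  | load (d a : ℕ) (s : State w) (h : (s.reg a).toNat < M) :
      Exec T M (.load d a) s 1
        { s with reg := Function.update s.reg d (s.mem (s.reg a).toNat) }
  | store (a b : ℕ) (s : State w) (h : (s.reg a).toNat < M) :
      Exec T M (.store a b) s 1
        { s with mem := Function.update s.mem (s.reg a).toNat (s.reg b) }
  | seq {P Q : Prog} {s s₁ s₂ : State w} {t₁ t₂ : ℕ} (h₁ : Exec T M P s t₁ s₁)
      (h₂ : Exec T M Q s₁ t₂ s₂) : Exec T M (.seq P Q) s (t₁ + t₂) s₂
  | cond_true {c : Test} {P Q : Prog} {s s' : State w} {t : ℕ} (hc : c.eval T s = some true)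
      (h : Exec T M P s t s') : Exec T M (.cond c P Q) s (t + 1) s'
  | cond_false {c : Test} {P Q : Prog} {s s' : State w} {t : ℕ} (hc : c.eval T s = some false)
      (h : Exec T M Q s t s') : Exec T M (.cond c P Q) s (t + 1) s'
  | loop_true {c : Test} {P : Prog} {s s₁ s₂ : State w} {t₁ t₂ : ℕ} (hc : c.eval T s = some true)
      (h₁ : Exec T M P s t₁ s₁) (h₂ : Exec T M (.loop c P) s₁ t₂ s₂) :
      Exec T M (.loop c P) s (t₁ + t₂ + 1) s₂
  | loop_false {c : Test} {P : Prog} {s : State w} (hc : c.eval T s = some false) :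
      Exec T M (.loop c P) s 1 s

/-- Initial state for an input string of length `n`: register `0` holds `n`, all other registers
and all memory cells hold `0`. -/
def State.init (w n : ℕ) : State w where
  reg := Function.update (fun _ => 0) 0 (BitVec.ofNat w n)
  mem := fun _ => 0

/-- The output: register `0` holds its length `ℓ`, and memory cells `0, …, ℓ - 1` hold its
entries. -/
def State.output {w : ℕ} (s : State w) : List ℕ :=
  (List.range (s.reg 0).toNat).map fun k => (s.mem k).toNat

end WordRAM

/-!
The longest Lyndon subsequences of the input `f 0, …, f (n - 1)` are found by visiting Lyndon
subsequences `w` in lexicographic order, in the manner of Duval's algorithm, each by its leftmost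
embedding.

*The next word.* Every prefix of a Lyndon word is a prefix of a power of its longest Lyndon
prefix `u`, and a symbol appended to it makes it a Lyndon word if it is larger than the symbol
continuing this period (`LyndonFun.duval`), and cannot be continued to a Lyndon word if it is
smaller (`LyndonFun.le_of_period`). So the Lyndon subsequences larger than `w` branch off the
longest periodic continuation of `w` that embeds into the input (`IsMaxStack.branch`), with a larger
symbol than the period asks for; the deepest branch comes first.

*Pruning.* Let `L q` be the largest length of a visited word that embeds into the first `q + 1`
symbols. A branch of length `k + 1` ending at position `q` is skipped if `L q > k`: some Lyndon word
`a` that is smaller than the branch is at least as long and ends no later, and replacing the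
branch by `a` in a Lyndon word `v` yields a smaller Lyndon subsequence that is at least as long
(`LyndonFun.exchange`). Hence no skipped word can be the one sought, by induction along the
lexicographic order (`IsMaxStack.dominates`), and the first visited word of maximum length is the
answer (`IsBest.isLeast`).

*Time.* Each visited word increases an entry of `L`, and entries are at most `n`, so there are at
most `n ^ 2` rounds. A round takes `O(n)` steps: `L` is monotone, so whether the stack can be left
after `k` symbols depends only on the first position with a larger symbol. This position does not
depend on `L`. It is either met while the period is continued, or is the next greater position of
the one that continues the period, which is tabulated beforehand (`IsExtending.push`).

The program is verified with a weakest-precondition calculus on natural numbers (`wp_sound`) in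
which loops carry an invariant and a potential for the time; `wp_round` is the round of the main
loop.
-/

/-! ### Lyndon words given by a symbol function -/

section Words

variable {α : Type*}

/-- The string `g 0, …, g (k - 1)`. -/
def word (g : ℕ → α) (k : ℕ) : List α := (List.range k).map g

@[simp] lemma length_word (g : ℕ → α) (k : ℕ) : (word g k).length = k := by simp [word]

@[simp] lemma getElem_word (g : ℕ → α) (k i : ℕ) (h : i < (word g k).length) :
    (word g k)[i] = g i := by simp [word]

lemma word_congr {g h : ℕ → α} {k : ℕ} (H : ∀ i < k, g i = h i) : word g k = word h k := by
  apply List.map_congr_left; intro a ha; exact H a (List.mem_range.1 ha)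

lemma exists_word (d : α) (v : List α) : ∃ g, v = word g v.length :=
  ⟨fun i => v.getD i d, List.ext_getElem (by simp) (by intro i h1 h2; simp [h1])⟩

lemma drop_word (g : ℕ → α) (k r : ℕ) : (word g k).drop r = word (fun i => g (i + r)) (k - r) :=
  List.ext_getElem (by simp) (by intro i h1 h2; simp [add_comm])

lemma take_word (g : ℕ → α) (k r : ℕ) (h : r ≤ k) : (word g k).take r = word g r :=
  List.ext_getElem (by simp [h]) (by intro i h1 h2; simp)

lemma word_append_drop (a h : ℕ → α) (p k l : ℕ) :
    word a p ++ (word h l).drop k =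
      word (fun i => if i < p then a i else h (i - p + k)) (p + (l - k)) := by
  apply List.ext_getElem (by simp)
  intro i h1 h2
  rw [List.getElem_append]
  simp only [length_word, getElem_word, List.getElem_drop]
  split_ifs
  · rfl
  · rw [add_comm]

lemma sublist_drop_of_cons_sublist {c : α} {y T : List α} :
    ∀ {s q : ℕ} (_ : (c :: y).Sublist (T.drop s))
      (_ : ∀ i (h : i < T.length), s ≤ i → i < q → T[i] ≠ c), s ≤ q →
      (c :: y).Sublist (T.drop q) := by
  intro s q h hne hsq
  induction q, hsq using Nat.le_induction with
  | base => exact h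
  | succ q hsq ih =>
    have := ih (fun i hi h1 h2 => hne i hi h1 (by omega))
    rcases Nat.lt_or_ge q T.length with hq | hq
    · rw [List.drop_eq_getElem_cons hq] at this
      rcases this with _ | h' | h'
      · assumption
      · exact absurd rfl (hne q hq hsq (by omega))
    · rw [List.drop_eq_nil_of_le hq] at this
      exact absurd (List.eq_nil_of_sublist_nil this) (by simp)

/-- The tail of a subsequence can be embedded behind the first occurrence of its head. -/
lemma sublist_drop_succ {c : α} {y T : List α} {s q : ℕ} (h : (c :: y).Sublist (T.drop s))
    (hq : q < T.length) (hc : T[q] = c) (hne : ∀ i (h : i < T.length), s ≤ i → i < q → T[i] ≠ c)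
    (hsq : s ≤ q) : y.Sublist (T.drop (q + 1)) := by
  have := sublist_drop_of_cons_sublist h hne hsq
  rw [List.drop_eq_getElem_cons hq, hc] at this
  exact List.cons_sublist_cons.1 this

lemma exists_first_of_cons_sublist {c : α} {y T : List α} {s : ℕ}
    (h : (c :: y).Sublist (T.drop s)) :
    ∃ q, ∃ hq : q < T.length, s ≤ q ∧ T[q] = c ∧
      ∀ i (h : i < T.length), s ≤ i → i < q → T[i] ≠ c := by
  classical
  have hmem : c ∈ T.drop s := h.subset (by simp)
  have hex : ∃ q, s ≤ q ∧ ∃ hq : q < T.length, T[q] = c := by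
    obtain ⟨i, hi, h⟩ := List.getElem_of_mem hmem
    simp only [List.length_drop] at hi
    exact ⟨s + i, by omega, by omega, by simpa using h⟩
  obtain ⟨h1, h2, h3⟩ := Nat.find_spec hex
  exact ⟨Nat.find hex, h2, h1, h3, fun i hi hsi hlt he => Nat.find_min hex hlt ⟨hsi, hi, he⟩⟩

variable [LinearOrder α]

lemma word_lt_word {g h : ℕ → α} {k l : ℕ} :
    word g k < word h l ↔
      (k < l ∧ ∀ i < k, g i = h i) ∨ ∃ j, j < k ∧ j < l ∧ (∀ i < j, g i = h i) ∧ g j < h j := by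
  rw [List.lt_iff_exists]
  constructor
  · rintro (⟨h1, h2⟩ | ⟨i, h1, h2, h3, h4⟩)
    · left
      simp only [length_word] at h1 h2
      refine ⟨h2, fun i hi => ?_⟩
      rw [take_word _ _ _ h2.le] at h1
      have := congrArg (fun l => l[i]?) h1
      simpa [word, hi] using this
    · right
      simp only [length_word, getElem_word] at h1 h2 h3 h4
      exact ⟨i, h1, h2, h3, h4⟩
  · rintro (⟨h1, h2⟩ | ⟨i, h1, h2, h3, h4⟩)
    · left
      simp only [length_word]
      exact ⟨by rw [take_word _ _ _ h1.le]; exact word_congr h2, h1⟩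
    · right
      exact ⟨i, by simpa, by simpa, by simpa using h3, by simpa⟩

/-- The string `g 0, …, g (k - 1)` is a Lyndon word: each proper suffix first differs from the
whole string at one of its own symbols, and is larger there. -/
def LyndonFun (g : ℕ → α) (k : ℕ) : Prop :=
  0 < k ∧ ∀ r, 0 < r → r < k → ∃ j, j + r < k ∧ (∀ i < j, g i = g (i + r)) ∧ g j < g (j + r)

lemma isLyndon_word {g : ℕ → α} {k : ℕ} : IsLyndon (word g k) ↔ LyndonFun g k := by
  constructor
  · rintro ⟨h0, h⟩
    have hk : 0 < k := by
      rcases Nat.eq_zero_or_pos k with rfl | hk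
      · exact absurd rfl h0
      · exact hk
    refine ⟨hk, fun r hr hrk => ?_⟩
    have := h _ (List.drop_suffix r (word g k))
      (by intro H; have := congrArg List.length H; simp at this; omega)
      (by intro H; have := congrArg List.length H; simp at this; omega)
    rw [drop_word, word_lt_word] at this
    rcases this with h | ⟨j, h1, h2, h3, h4⟩
    · omega
    · exact ⟨j, by omega, h3, h4⟩
  · rintro ⟨hk, h⟩
    refine ⟨by intro H; have := congrArg List.length H; simp at this; omega, ?_⟩
    intro V hV hne hne'
    have hle := hV.length_le
    have hV' := List.suffix_iff_eq_drop.1 hV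
    have hpos := List.length_pos_of_ne_nil hne
    have hlt : V.length ≠ (word g k).length := fun H => hne' (hV.eq_of_length H)
    simp only [length_word] at hle hlt hV'
    obtain ⟨j, h1, h2, h3⟩ := h (k - V.length) (by omega) (by omega)
    rw [hV', drop_word, word_lt_word]
    exact Or.inr ⟨j, by omega, by omega, h2, h3⟩

/-- In a Lyndon word whose prefix of length `k` has period `p`, the next symbol is at least the
one that continues the period. -/
lemma LyndonFun.le_of_period {g : ℕ → α} {l p k : ℕ} (h : LyndonFun g l) (hp : 0 < p) (hpk : p ≤ k)
    (hk : k < l) (hper : ∀ j, p ≤ j → j < k → g j = g (j - p)) : g (k - p) ≤ g k := by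
  obtain ⟨j, h1, h2, h3⟩ := h.2 p hp (by omega)
  have key : ¬ j < k - p := fun hj => by
    have := hper (j + p) (by omega) (by omega)
    simp only [Nat.add_sub_cancel] at this
    rw [this] at h3; exact lt_irrefl _ h3
  rcases Nat.lt_or_ge (k - p) j with hj | hj
  · have := h2 _ hj
    rw [Nat.sub_add_cancel hpk] at this; exact this.le
  · obtain rfl : j = k - p := by omega
    rw [Nat.sub_add_cancel hpk] at h3; exact h3.le

/-- A Lyndon word has no proper period. -/
lemma LyndonFun.not_period {g : ℕ → α} {l p : ℕ} (h : LyndonFun g l) (hp : 0 < p) (hpl : p < l) :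
    ¬ ∀ j, p ≤ j → j < l → g j = g (j - p) := by
  intro hper
  obtain ⟨j, h1, h2, h3⟩ := h.2 p hp hpl
  have := hper (j + p) (by omega) h1
  simp only [Nat.add_sub_cancel] at this
  rw [this] at h3; exact lt_irrefl _ h3

/-- Duval's lemma: if the prefix of length `k` of `g` has a Lyndon prefix as a period, then a symbol
larger than the one continuing the period makes it a Lyndon word. -/
lemma LyndonFun.duval {g : ℕ → α} {p k : ℕ} (h : LyndonFun g p) (hpk : p ≤ k)
    (hper : ∀ j, p ≤ j → j < k → g j = g (j - p)) (hlt : g (k - p) < g k) :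
    LyndonFun g (k + 1) := by
  have hp := h.1
  refine ⟨by omega, fun r hr hrk => ?_⟩
  -- `f` is the infinite periodic word; it agrees with `g` below `k`
  set f : ℕ → α := fun j => g (j % p) with hf
  have hfg : ∀ j, j < k → g j = f j := by
    intro j
    induction j using Nat.strong_induction_on with
    | _ j ih =>
      intro hj
      rcases Nat.lt_or_ge j p with hjp | hjp
      · simp [hf, Nat.mod_eq_of_lt hjp]
      · rw [hper j hjp hj, ih (j - p) (by omega) (by omega)]
        simp only [hf, Nat.mod_eq_sub_mod hjp]
  have hfk : f k < g k := by
    have : f k = g (k - p) := by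
      rw [hfg _ (by omega)]; simp only [hf, Nat.mod_eq_sub_mod hpk]
    rwa [this]
  have hshift : ∀ j, f (j + r) = f (j + r % p) := by
    intro j; simp [hf, Nat.add_mod]
  by_cases hr0 : r % p = 0
  · refine ⟨k - r, by omega, fun i hi => ?_, ?_⟩
    · rw [hfg i (by omega), hfg (i + r) (by omega), hshift, hr0]; rfl
    · rw [Nat.sub_add_cancel (by omega), hfg (k - r) (by omega)]
      have : f (k - r) = f k := by
        conv_rhs => rw [show k = (k - r) + r by omega, hshift, hr0]
        rfl
      rw [this]; exact hfk
  · obtain ⟨j, h1, h2, h3⟩ := h.2 (r % p) (by omega) (Nat.mod_lt _ hp)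
    have hfs : ∀ i, i < p → g i = f i := fun i hi => by simp [hf, Nat.mod_eq_of_lt hi]
    have e1 : ∀ i < j, f i = f (i + r) := fun i hi => by
      rw [hshift, ← hfs i (by omega), ← hfs _ (by omega)]; exact h2 i hi
    have e2 : f j < f (j + r) := by
      rw [hshift, ← hfs j (by omega), ← hfs _ (by omega)]; exact h3
    rcases Nat.lt_or_ge (j + r) k with hjk | hjk
    · refine ⟨j, by omega, fun i hi => ?_, ?_⟩
      · rw [hfg i (by omega), hfg (i + r) (by omega)]; exact e1 i hi
      · rw [hfg j (by omega), hfg (j + r) (by omega)]; exact e2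
    · refine ⟨k - r, by omega, fun i hi => ?_, ?_⟩
      · rw [hfg i (by omega), hfg (i + r) (by omega)]; exact e1 i (by omega)
      · rw [Nat.sub_add_cancel (by omega), hfg (k - r) (by omega)]
        have hle : f (k - r) ≤ f k := by
          rcases Nat.lt_or_ge (k - r) j with hj | hj
          · rw [e1 _ hj, Nat.sub_add_cancel (by omega)]
          · obtain rfl : j = k - r := by omega
            rw [Nat.sub_add_cancel (by omega)] at e2; exact e2.le
        exact hle.trans_lt hfk

/-- The exchange lemma behind pruning: in a Lyndon word `h`, the prefix of length `k + 1` can be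
replaced by a Lyndon word `a` that is at least as long and differs from the prefix, at a position
where it is smaller. -/
lemma LyndonFun.exchange {a h : ℕ → α} {p k l j : ℕ} (ha : LyndonFun a p) (hh : LyndonFun h l)
    (hkp : k + 1 ≤ p) (hkl : k + 1 ≤ l) (hjk : j ≤ k) (heq : ∀ i < j, a i = h i) (hlt : a j < h j) :
    LyndonFun (fun i => if i < p then a i else h (i - p + (k + 1))) (p + (l - (k + 1))) := by
  refine ⟨by omega, fun r hr hrl => ?_⟩
  rcases Nat.lt_or_ge r p with hrp | hrp
  · obtain ⟨j', h1, h2, h3⟩ := ha.2 r hr hrp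
    refine ⟨j', by omega, fun i hi => ?_, ?_⟩
    · simp only [show i < p by omega, show i + r < p by omega, if_true]; exact h2 i hi
    · simp only [show j' < p by omega, h1, if_true]; exact h3
  · obtain ⟨j', h1, h2, h3⟩ := hh.2 (r - p + (k + 1)) (by omega) (by omega)
    have e : ∀ i, (if i + r < p then a (i + r) else h (i + r - p + (k + 1)))
        = h (i + (r - p + (k + 1))) := fun i => by
      rw [if_neg (by omega)]; congr 1; omega
    rcases Nat.lt_or_ge j j' with hj | hj
    · refine ⟨j, by omega, fun i hi => ?_, ?_⟩
      · simp only [e, show i < p by omega, if_true]; rw [heq i hi, h2 i (by omega)]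
      · simp only [e, show j < p by omega, if_true]; rw [← h2 j hj]; exact hlt
    · refine ⟨j', by omega, fun i hi => ?_, ?_⟩
      · simp only [e, show i < p by omega, if_true]; rw [heq i (by omega), h2 i (by omega)]
      · simp only [e, show j' < p by omega, if_true]
        refine lt_of_le_of_lt ?_ h3
        rcases Nat.lt_or_ge j' j with h' | h'
        · exact (heq _ h').le
        · obtain rfl : j = j' := by omega
          exact hlt.le

end Words

/-! ### Leftmost embeddings of prefixes of Lyndon words -/

section Stack

variable {α : Type*} [LinearOrder α]

/-- The first position of the input that is free for the symbol number `k` of an embedding `P`. -/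
def start (P : ℕ → ℕ) : ℕ → ℕ
  | 0 => 0
  | k + 1 => P k + 1

lemma start_congr {P P' : ℕ → ℕ} {k : ℕ} (h : ∀ i < k, P' i = P i) : start P' k = start P k := by
  cases k with
  | zero => rfl
  | succ k => simp [start, h k (by omega)]

/-- The symbol at position `q` is larger than the one continuing the period of the first `k`
symbols of the embedding `P`, so that appending it yields a Lyndon word. -/
def Larger (f : ℕ → α) (P per : ℕ → ℕ) (k q : ℕ) : Prop :=
  k = 0 ∨ f (P (k - per (k - 1))) < f q

/-- `q` is the first position free for symbol number `k` that holds a larger symbol than the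
periodic continuation, and is `n` if there is none. -/
structure IsFirstLarger (f : ℕ → α) (n : ℕ) (P per : ℕ → ℕ) (k q : ℕ) : Prop where
  start_le : start P k ≤ q
  le : q ≤ n
  larger : q < n → Larger f P per k q
  not_larger : ∀ i, start P k ≤ i → i < q → ¬ Larger f P per k i

/-- The positions `P 0, …, P (e - 1)` form the leftmost embedding into `f 0, …, f (n - 1)` of a
string all of whose prefixes are prefixes of powers of Lyndon words: the prefix of length `i + 1`
has a Lyndon prefix of length `per i` as a period. The table `next` holds for each proper prefix
the first position at which it can be continued to a Lyndon word. -/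
structure IsStack (f : ℕ → α) (n : ℕ) (P per next : ℕ → ℕ) (e : ℕ) : Prop where
  lt : ∀ i < e, P i < n
  start_le : ∀ i < e, start P i ≤ P i
  first : ∀ i < e, ∀ q, start P i ≤ q → q < P i → f q ≠ f (P i)
  per_le : ∀ i < e, per i ≤ i + 1
  lyndon : ∀ i < e, LyndonFun (fun j => f (P j)) (per i)
  period : ∀ i < e, ∀ j, per i ≤ j → j ≤ i → f (P j) = f (P (j - per i))
  next : ∀ i < e, IsFirstLarger f n P per i (next i)

lemma Larger.congr {f : ℕ → α} {P per P' per' : ℕ → ℕ} {k q : ℕ}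
    (hp : ∀ i < k, 0 < per i) (hP : ∀ i < k, P' i = P i) (hper : ∀ i < k, per' i = per i) :
    Larger f P' per' k q ↔ Larger f P per k q := by
  unfold Larger
  rcases Nat.eq_zero_or_pos k with rfl | hk
  · simp
  · have := hp (k - 1) (by omega)
    rw [hper (k - 1) (by omega), hP _ (by omega)]

lemma IsFirstLarger.congr {f : ℕ → α} {n : ℕ} {P per P' per' : ℕ → ℕ} {k q : ℕ}
    (h : IsFirstLarger f n P per k q)
    (hp : ∀ i < k, 0 < per i) (hP : ∀ i < k, P' i = P i) (hper : ∀ i < k, per' i = per i) :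
    IsFirstLarger f n P' per' k q where
  start_le := by rw [start_congr hP]; exact h.start_le
  le := h.le
  larger hq := (Larger.congr hp hP hper).2 (h.larger hq)
  not_larger i h1 h2 h3 :=
    h.not_larger i (by rwa [start_congr hP] at h1) h2 ((Larger.congr hp hP hper).1 h3)

namespace IsStack

variable {f : ℕ → α} {n e : ℕ} {P per next : ℕ → ℕ}

lemma per_pos (h : IsStack f n P per next e) : ∀ i < e, 0 < per i := fun i hi => (h.lyndon i hi).1

lemma congr (h : IsStack f n P per next e) {P' per' next' : ℕ → ℕ} (hP : ∀ i < e, P' i = P i)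
    (hper : ∀ i < e, per' i = per i) (hnext : ∀ i < e, next' i = next i) :
    IsStack f n P' per' next' e where
  lt i hi := by rw [hP i hi]; exact h.lt i hi
  start_le i hi := by
    rw [hP i hi, start_congr (fun j hj => hP j (by omega))]; exact h.start_le i hi
  first i hi := by
    rw [hP i hi, start_congr (fun j hj => hP j (by omega))]; exact h.first i hi
  per_le i hi := by rw [hper i hi]; exact h.per_le i hi
  lyndon i hi := by
    rw [hper i hi]
    rw [← isLyndon_word, word_congr (h := fun j => f (P j)), isLyndon_word]
    · exact h.lyndon i hi
    · intro j hj
      have := h.per_le i hi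
      simp only [hP j (by omega)]
  period i hi j h1 h2 := by
    rw [hper i hi] at h1 ⊢
    rw [hP j (by omega), hP _ (by omega)]
    exact h.period i hi j h1 h2
  next i hi := by
    rw [hnext i hi]
    exact (h.next i hi).congr (fun j hj => h.per_pos j (by omega)) (fun j hj => hP j (by omega))
      (fun j hj => hper j (by omega))

lemma mono (h : IsStack f n P per next e) {k : ℕ} (hk : k ≤ e) : IsStack f n P per next k where
  lt i hi := h.lt i (by omega)
  start_le i hi := h.start_le i (by omega)
  first i hi := h.first i (by omega)
  per_le i hi := h.per_le i (by omega)
  lyndon i hi := h.lyndon i (by omega)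
  period i hi := h.period i (by omega)
  next i hi := h.next i (by omega)

lemma empty : IsStack f n P per next 0 := by constructor <;> simp

lemma pos_lt (h : IsStack f n P per next e) {i j : ℕ} (hij : i < j) (hj : j < e) : P i < P j := by
  induction j with
  | zero => omega
  | succ j ih =>
    have h1 := h.start_le (j + 1) hj
    simp only [start] at h1
    rcases Nat.lt_or_ge i j with h2 | h2
    · have := ih h2 (by omega); omega
    · obtain rfl : i = j := by omega
      omega

lemma le_start (h : IsStack f n P per next e) : ∀ k ≤ e, k ≤ start P k := by
  intro k
  induction k with
  | zero => intro _; exact Nat.zero_le _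
  | succ k ih =>
    intro hk
    have h1 := ih (by omega)
    have h2 := h.start_le k (by omega)
    simp only [start]; omega

lemma start_le_n (h : IsStack f n P per next e) : ∀ k ≤ e, start P k ≤ n := by
  intro k hk
  cases k with
  | zero => exact Nat.zero_le _
  | succ k => exact h.lt k (by omega)

lemma push_equal (h : IsStack f n P per next e) (he : 0 < e) (hn : P e < n)
    (hs : start P e ≤ P e) (hfst : ∀ q, start P e ≤ q → q < P e → f q ≠ f (P e))
    (hper : per e = per (e - 1)) (hx : f (P e) = f (P (e - per e)))
    (hnext : IsFirstLarger f n P per e (next e)) : IsStack f n P per next (e + 1) := by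
  have hle := h.per_le (e - 1) (by omega)
  refine ⟨?_, ?_, ?_, ?_, ?_, ?_, ?_⟩ <;> intro i hi <;>
    rcases Nat.lt_succ_iff_lt_or_eq.1 hi with hi | rfl
  · exact h.lt i hi
  · exact hn
  · exact h.start_le i hi
  · exact hs
  · exact h.first i hi
  · exact hfst
  · exact h.per_le i hi
  · omega
  · exact h.lyndon i hi
  · rw [hper]; exact h.lyndon _ (by omega)
  · exact h.period i hi
  · intro j h1 h2
    rcases Nat.lt_or_eq_of_le h2 with h3 | rfl
    · rw [hper] at h1 ⊢
      exact h.period _ (by omega) j h1 (by omega)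
    · exact hx
  · exact h.next i hi
  · exact hnext

/-- Appending a larger symbol than the periodic continuation yields a Lyndon word. -/
lemma lyndon_of_larger (h : IsStack f n P per next e) (hl : Larger f P per e (P e)) :
    LyndonFun (fun j => f (P j)) (e + 1) := by
  rcases Nat.eq_zero_or_pos e with rfl | he
  · exact ⟨by omega, fun r h1 h2 => by omega⟩
  · have hle := h.per_le (e - 1) (by omega)
    refine LyndonFun.duval (h.lyndon (e - 1) (by omega)) (by omega)
      (fun j h1 h2 => h.period (e - 1) (by omega) j h1 (by omega)) ?_
    rcases hl with hl | hl
    · omega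
    · exact hl

lemma push_larger (h : IsStack f n P per next e) (hn : P e < n)
    (hs : start P e ≤ P e) (hfst : ∀ q, start P e ≤ q → q < P e → f q ≠ f (P e))
    (hper : per e = e + 1) (hl : Larger f P per e (P e))
    (hnext : IsFirstLarger f n P per e (next e)) : IsStack f n P per next (e + 1) := by
  refine ⟨?_, ?_, ?_, ?_, ?_, ?_, ?_⟩ <;> intro i hi <;>
    rcases Nat.lt_succ_iff_lt_or_eq.1 hi with hi | rfl
  · exact h.lt i hi
  · exact hn
  · exact h.start_le i hi
  · exact hs
  · exact h.first i hi
  · exact hfst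
  · exact h.per_le i hi
  · omega
  · exact h.lyndon i hi
  · rw [hper]; exact h.lyndon_of_larger hl
  · exact h.period i hi
  · intro j h1 h2; omega
  · exact h.next i hi
  · exact hnext

lemma sublist (h : IsStack f n P per next e) : ∀ k ≤ e,
    (word (fun j => f (P j)) k).Sublist ((word f n).take (start P k)) := by
  intro k
  induction k with
  | zero => intro _; exact List.nil_sublist _
  | succ k ih =>
    intro hk
    have h1 := ih (by omega)
    have h2 := h.lt k (by omega)
    have h3 := h.start_le k (by omega)
    rw [take_word _ _ _ (by omega)] at h1
    simp only [start]
    rw [take_word _ _ _ (by omega)]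
    have e : word (fun j => f (P j)) (k + 1) = word (fun j => f (P j)) k ++ [f (P k)] := by
      simp [word, List.range_succ]
    have e' : word f (P k + 1) = word f (P k) ++ [f (P k)] := by
      simp [word, List.range_succ]
    rw [e, e']
    refine (h1.trans ?_).append (List.Sublist.refl _)
    rw [← take_word f (P k) _ h3]; exact List.take_sublist _ _

/-- The embedding of a stack is leftmost: the rest of a subsequence that agrees with the stack on
the first `k` symbols can be embedded behind the first `k` positions of the stack. -/
lemma drop_sublist (h : IsStack f n P per next e) {g : ℕ → α} {l : ℕ}
    (hv : (word g l).Sublist (word f n)) : ∀ k ≤ e, k ≤ l → (∀ i < k, g i = f (P i)) →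
      ((word g l).drop k).Sublist ((word f n).drop (start P k)) := by
  intro k
  induction k with
  | zero => intro _ _ _; simpa [start] using hv
  | succ k ih =>
    intro hk hl heq
    have h1 := ih (by omega) (by omega) (fun i hi => heq i (by omega))
    rw [List.drop_eq_getElem_cons (by simpa using hl), getElem_word, heq k (by omega)] at h1
    have h2 := h.lt k (by omega)
    refine sublist_drop_succ (q := P k) h1 (by simpa using h2) (by simp) ?_
      (h.start_le k (by omega))
    intro i hi h3 h4
    rw [getElem_word]; exact h.first k (by omega) i h3 h4

end IsStack

/-! ### Pruning -/

/-- The table `L` of pruning lengths: some Lyndon subsequence that is lexicographically at most `w`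
can be embedded into the first `q + 1` symbols and has length at least `L q`. The sentinel at `n`
exceeds every length. -/
structure IsTable (f : ℕ → α) (n : ℕ) (L : ℕ → ℕ) (w : List α) : Prop where
  mono : ∀ q q', q ≤ q' → q' ≤ n → L q ≤ L q'
  top : L n = n + 1
  le : ∀ q < n, L q ≤ n
  witness : ∀ q < n, L q ≠ 0 → ∃ v, IsLyndon v ∧ v ≤ w ∧ L q ≤ v.length ∧
    v.Sublist ((word f n).take (q + 1))

/-- `B` is longer than `v`, or as long and not lexicographically larger. -/
def Dominates (B v : List α) : Prop :=
  v.length < B.length ∨ v.length = B.length ∧ B ≤ v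

/-- `B` is the best Lyndon subsequence of `T` that is at most `w`, and is empty if there is none. -/
structure IsBest (T B w : List α) : Prop where
  eq_nil_or : B = [] ∨ IsLyndon B ∧ B.Sublist T
  le : B ≤ w
  dominates : ∀ v, IsLyndon v → v.Sublist T → v ≤ w → Dominates B v

/-- The stack consists of the word of length `m`, which is a Lyndon word unless the stack is empty,
and of its longest leftmost embeddable periodic continuation. -/
structure IsMaxStack (f : ℕ → α) (n : ℕ) (P per next : ℕ → ℕ) (m e : ℕ) : Prop where
  stack : IsStack f n P per next e
  next_top : IsFirstLarger f n P per e (next e)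
  le : m ≤ e
  pos : 0 < m ∨ e = 0
  per_eq : ∀ i < e, m ≤ i + 1 → per i = m
  maximal : 0 < e → ∀ q, start P e ≤ q → q < n → f q ≠ f (P (e - per (e - 1)))

/-- The symbol at position `b` is the smallest one that makes the first `j` symbols of the stack a
Lyndon word of length `j + 1` not pruned by the table `L`, and `b` is its first free position. -/
structure IsChild (f : ℕ → α) (n : ℕ) (P per L : ℕ → ℕ) (j b : ℕ) : Prop where
  start_le : start P j ≤ b
  lt : b < n
  larger : Larger f P per j b
  first : ∀ q, start P j ≤ q → q < b → f q ≠ f b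
  table : L b ≤ j
  min : ∀ q, start P j ≤ q → q < n → Larger f P per j q → L q ≤ j → f b ≤ f q

variable {f : ℕ → α} {n m e : ℕ} {P per next L : ℕ → ℕ}

/-- A Lyndon subsequence `v` beyond the current word `w` leaves the stack after `k` symbols, with a
symbol `v k` larger than the periodic continuation and larger than the symbol of the stack. -/
lemma IsMaxStack.branch (H : IsMaxStack f n P per next m e) {g : ℕ → α} {l : ℕ}
    (hv : LyndonFun g l) (hsub : (word g l).Sublist (word f n))
    (hw : word (fun j => f (P j)) m < word g l) :
    ∃ k q, k < l ∧ k ≤ e ∧ (∀ i < k, g i = f (P i)) ∧ (k < e → f (P k) < g k) ∧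
      start P k ≤ q ∧ q < n ∧ f q = g k ∧ Larger f P per k q ∧
      ((word g l).drop (k + 1)).Sublist ((word f n).drop (q + 1)) := by
  classical
  have hS := H.stack
  have hex : ∃ k, ¬ (k < l ∧ k < e ∧ g k = f (P k)) := ⟨l, by omega⟩
  obtain ⟨k, hk, hmin⟩ : ∃ k, ¬ (k < l ∧ k < e ∧ g k = f (P k)) ∧
      ∀ i < k, i < l ∧ i < e ∧ g i = f (P i) :=
    ⟨Nat.find hex, Nat.find_spec hex, fun i hi => not_not.1 (Nat.find_min hex hi)⟩
  have hkl : k ≤ l := by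
    by_contra hc; exact absurd (hmin l (by omega)).1 (lt_irrefl _)
  have hke : k ≤ e := by
    by_contra hc; exact absurd (hmin e (by omega)).2.1 (lt_irrefl _)
  have heq : ∀ i < k, g i = f (P i) := fun i hi => (hmin i hi).2.2
  -- a prefix of the stack that extends `w` is periodic, hence not a Lyndon word
  have hkl' : k < l := by
    refine lt_of_le_of_ne hkl fun hkl => ?_
    subst hkl
    have hm : m < k := by
      rcases word_lt_word.1 hw with h | ⟨j, h1, h2, h3, h4⟩
      · exact h.1
      · rw [heq j h2] at h4; exact absurd h4 (lt_irrefl _)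
    have hp := H.per_eq (k - 1) (by omega) (by omega)
    have hpos := H.pos
    refine hv.not_period (p := m) (by omega) hm fun j h1 h2 => ?_
    rw [heq j h2, heq _ (by omega), ← hp]
    exact hS.period (k - 1) (by omega) j (by omega) (by omega)
  have h1 := hS.drop_sublist hsub k hke hkl heq
  rw [List.drop_eq_getElem_cons (by simpa using hkl'), getElem_word] at h1
  obtain ⟨q, hq, hsq, hfq, hfirst⟩ := exists_first_of_cons_sublist h1
  have hrest := sublist_drop_succ h1 hq hfq hfirst hsq
  simp only [length_word] at hq
  rw [getElem_word] at hfq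
  -- if the branch leaves `w` itself, its symbol is larger than that of `w`
  have hbelow : k < m → f (P k) < g k := by
    intro hkm
    rcases word_lt_word.1 hw with h | ⟨j, h1, h2, h3, h4⟩
    · exact absurd ⟨hkl', by have := H.le; omega, (h.2 k hkm).symm⟩ hk
    · rcases lt_trichotomy j k with hj | rfl | hj
      · rw [heq j hj] at h4; exact absurd h4 (lt_irrefl _)
      · exact h4
      · exact absurd ⟨hkl', by have := H.le; omega, (h3 k hj).symm⟩ hk
  have hlarger : 0 < k → f (P (k - per (k - 1))) < g k := by
    intro hk0
    have hper := hS.per_le (k - 1) (by omega)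
    have hpp := hS.per_pos (k - 1) (by omega)
    rcases Nat.lt_or_ge k m with hkm | hkm
    · have hme := H.le
      have hw : LyndonFun (fun j => f (P j)) m := by
        have := hS.lyndon (m - 1) (by omega)
        rwa [H.per_eq (m - 1) (by omega) (by omega)] at this
      refine lt_of_le_of_lt ?_ (hbelow hkm)
      exact hw.le_of_period hpp (by omega) hkm
        (fun j h1 h2 => hS.period (k - 1) (by omega) j h1 (by omega))
    · have hle : f (P (k - per (k - 1))) ≤ g k := by
        have := hv.le_of_period (p := per (k - 1)) (k := k) hpp (by omega) hkl' ?_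
        · rwa [heq _ (by omega)] at this
        · intro j h1 h2
          rw [heq j h2, heq _ (by omega)]
          exact hS.period (k - 1) (by omega) j h1 (by omega)
      refine lt_of_le_of_ne hle fun hc => ?_
      rcases Nat.lt_or_ge k e with hke' | hke'
      · apply hk
        refine ⟨hkl', hke', ?_⟩
        have e1 := H.per_eq k hke' (by omega)
        have e2 := H.per_eq (k - 1) (by omega) (by omega)
        have := hS.period k hke' k (by omega) le_rfl
        rw [← hc, this, e1, e2]
      · obtain rfl : k = e := by omega
        exact H.maximal hk0 q hsq hq (by rw [hc, hfq])
  refine ⟨k, q, hkl', hke, heq, fun hke' => ?_, hsq, hq, hfq, ?_, hrest⟩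
  · rcases Nat.lt_or_ge k m with hkm | hkm
    · exact hbelow hkm
    · have hpos := H.pos
      have := hlarger (by omega)
      have e1 := H.per_eq k hke' (by omega)
      have e2 := H.per_eq (k - 1) (by omega) (by omega)
      have e3 := hS.period k hke' k (by omega) le_rfl
      rw [e3, e1, ← e2]; exact this
  · rcases Nat.eq_zero_or_pos k with h0 | h0
    · exact Or.inl h0
    · right; rw [hfq]; exact hlarger h0

/-- A pruned Lyndon subsequence beyond `w` can be replaced by one that is smaller and at least as
long. -/
lemma IsMaxStack.exists_better (H : IsMaxStack f n P per next m e)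
    (HL : IsTable f n L (word (fun j => f (P j)) m)) {g : ℕ → α} {l k q : ℕ}
    (hv : LyndonFun g l) (hw : word (fun j => f (P j)) m < word g l)
    (hkl : k < l) (hke : k ≤ e) (heq : ∀ i < k, g i = f (P i)) (hlt : k < e → f (P k) < g k)
    (hq : q < n) (hL : k < L q)
    (hsub : ((word g l).drop (k + 1)).Sublist ((word f n).drop (q + 1))) :
    ∃ v, IsLyndon v ∧ v.Sublist (word f n) ∧ v < word g l ∧ l ≤ v.length := by
  obtain ⟨v, hvL, hvw, hvlen, hvsub⟩ := HL.witness q hq (by omega)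
  obtain ⟨a, ha⟩ := exists_word (g 0) v
  generalize v.length = p at ha hvlen
  subst ha
  rw [isLyndon_word] at hvL
  -- the witness differs from `v` within the first `k + 1` symbols
  obtain ⟨j, hjk, hja, haj⟩ : ∃ j ≤ k, (∀ i < j, a i = g i) ∧ a j < g j := by
    have hme := H.le
    have hle := hvw.trans_lt hw
    rcases word_lt_word.1 hle with ⟨h1, h2⟩ | ⟨j, h1, h2, h3, h4⟩
    · rcases Nat.lt_or_ge k m with hkm | hkm
      · -- here the witness would exceed `w`
        exfalso
        refine absurd hvw (not_le_of_gt (word_lt_word.2 (Or.inr ⟨k, hkm, by omega, ?_, ?_⟩)))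
        · intro i hi; rw [h2 i (by omega), heq i hi]
        · rw [h2 k (by omega)]; exact hlt (by omega)
      · exfalso
        refine absurd hvw (not_le_of_gt (word_lt_word.2 (Or.inl ⟨by omega, ?_⟩)))
        intro i hi; rw [h2 i (by omega), heq i (by omega)]
    · refine ⟨j, ?_, h3, h4⟩
      by_contra hc
      rcases Nat.lt_or_ge k m with hkm | hkm
      · refine absurd hvw (not_le_of_gt (word_lt_word.2 (Or.inr ⟨k, hkm, by omega, ?_, ?_⟩)))
        · intro i hi; rw [h3 i (by omega), heq i hi]
        · rw [h3 k (by omega)]; exact hlt (by omega)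
      · refine absurd hvw (not_le_of_gt (word_lt_word.2 (Or.inl ⟨by omega, ?_⟩)))
        intro i hi; rw [h3 i (by omega), heq i (by omega)]
  have hLyn := hvL.exchange hv (show k + 1 ≤ p by omega) (show k + 1 ≤ l by omega) hjk hja haj
  refine ⟨word a p ++ (word g l).drop (k + 1), ?_, ?_, ?_, ?_⟩
  · rw [word_append_drop]; exact isLyndon_word.2 hLyn
  · have := hvsub.append hsub
    rwa [List.take_append_drop] at this
  · rw [word_append_drop, word_lt_word]
    refine Or.inr ⟨j, by omega, by omega, fun i hi => ?_, ?_⟩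
    · rw [if_pos (by omega)]; exact hja i hi
    · rw [if_pos (by omega)]; exact haj
  · simp only [List.length_append, length_word, List.length_drop]; omega

lemma Dominates.of_better {B v v' : List α} (h : Dominates B v') (hlt : v' < v)
    (hlen : v.length ≤ v'.length) : Dominates B v := by
  rcases h with h | ⟨h1, h2⟩
  · exact Or.inl (by omega)
  · rcases Nat.lt_or_ge v.length v'.length with h3 | h3
    · exact Or.inl (by omega)
    · exact Or.inr ⟨by omega, h2.trans hlt.le⟩

/-- All Lyndon subsequences beyond `w` and before the next visited word are dominated: a smallest
exception would be pruned, hence have a better one before it. The number `J` is one more than the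
number of stack symbols kept by the next visited word, and `0` if there is no such word. -/
lemma IsMaxStack.dominates (H : IsMaxStack f n P per next m e)
    (HL : IsTable f n L (word (fun j => f (P j)) m)) {B : List α}
    (HB : IsBest (word f n) B (word (fun j => f (P j)) m)) {J b : ℕ}
    (hJ : ∀ k, J ≤ k → k ≤ e → k < L (next k))
    (hJe : J ≤ e + 1) (hb : J ≠ 0 → IsChild f n P per L (J - 1) b) {v : List α} (hv : IsLyndon v)
    (hsub : v.Sublist (word f n))
    (hlt : J ≠ 0 → v < word (fun j => f (P j)) (J - 1) ++ [f b]) : Dominates B v := by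
  classical
  by_contra hbad
  let s := (word f n).sublists.toFinset.filter
    (fun v => IsLyndon v ∧ (J ≠ 0 → v < word (fun j => f (P j)) (J - 1) ++ [f b]) ∧ ¬ Dominates B v)
  have hs : ∀ v, v ∈ s ↔ v.Sublist (word f n) ∧ IsLyndon v ∧
      (J ≠ 0 → v < word (fun j => f (P j)) (J - 1) ++ [f b]) ∧ ¬ Dominates B v := by
    intro v; simp [s]
  obtain ⟨v, hvs, hmin⟩ := s.exists_min_image id ⟨v, (hs v).2 ⟨hsub, hv, hlt, hbad⟩⟩
  obtain ⟨hsub, hv, hlt, hbad⟩ := (hs v).1 hvs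
  have hw : word (fun j => f (P j)) m < v := by
    by_contra hc; exact hbad (HB.dominates v hv hsub (not_lt.1 hc))
  obtain ⟨g, hg⟩ := exists_word (f 0) v
  generalize v.length = l at hg
  subst hg
  rw [isLyndon_word] at hv
  obtain ⟨k, q, hkl, hke, heq, hgt, hsq, hqn, hfq, hlarger, hrest⟩ := H.branch hv hsub hw
  rcases Nat.lt_or_ge k (L q) with hL | hL
  · obtain ⟨v', h1, h2, h3, h4⟩ := H.exists_better HL hv hw hkl hke heq hgt hqn hL hrest
    have : ¬ v' ∈ s := fun hc => absurd (hmin v' hc) (not_le_of_gt h3)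
    rw [hs] at this
    have hdom : Dominates B v' := by
      by_contra hc
      exact this ⟨h2, h1, fun hJ => h3.trans (hlt hJ), hc⟩
    exact hbad (hdom.of_better h3 (by simpa using h4))
  · -- an unpruned word is not before the next visited one
    have hnk : IsFirstLarger f n P per k (next k) := by
      rcases Nat.lt_or_eq_of_le hke with h | rfl
      · exact H.stack.next k h
      · exact H.next_top
    have hnq : next k ≤ q := by
      by_contra hc; exact hnk.not_larger q hsq (by omega) hlarger
    have hLk : L (next k) ≤ k := (HL.mono _ _ hnq hqn.le).trans hL
    have hkJ : k < J := by
      by_contra hc; exact absurd (hJ k (by omega) hke) (by omega)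
    have hb := hb (by omega)
    have hlt := hlt (by omega)
    refine absurd hlt (not_lt_of_ge ?_)
    have hword : word (fun j => f (P j)) (J - 1) ++ [f b]
        = word (fun i => if i < J - 1 then f (P i) else f b) (J - 1 + 1) := by
      apply List.ext_getElem (by simp)
      intro i h1 h2
      rw [List.getElem_append]
      simp
    rw [hword]
    rcases Nat.lt_or_ge k (J - 1) with h1 | h1
    · refine (word_lt_word.2 (Or.inr ⟨k, by omega, by omega, fun i hi => ?_, ?_⟩)).le
      · rw [if_pos (by omega), heq i hi]
      · rw [if_pos h1]; exact hgt (by omega)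
    · obtain rfl : k = J - 1 := by omega
      have hle := hb.min q hsq hqn hlarger hL
      rw [hfq] at hle
      rcases lt_or_eq_of_le hle with h2 | h2
      · refine (word_lt_word.2 (Or.inr ⟨J - 1, by omega, by omega, fun i hi => ?_, ?_⟩)).le
        · rw [if_pos (by omega), heq i hi]
        · rw [if_neg (by omega)]; exact h2
      · have : ∀ i < J - 1 + 1, (if i < J - 1 then f (P i) else f b) = g i := by
          intro i hi
          split_ifs with h
          · rw [heq i h]
          · obtain rfl : i = J - 1 := by omega
            exact h2
        rw [word_congr this]
        rcases Nat.lt_or_eq_of_le (show J - 1 + 1 ≤ l by omega) with h3 | h3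
        · exact (word_lt_word.2 (Or.inl ⟨h3, fun i _ => rfl⟩)).le
        · rw [h3]

end Stack

/-! ### Passing to the next word -/

section Transition

variable {α : Type*} [LinearOrder α] {f : ℕ → α} {n m e : ℕ} {P per next L : ℕ → ℕ}

/-- At the stack symbols that complete a Lyndon prefix, the table accounts for this prefix, and no
smaller symbol that keeps the prefix a Lyndon word is unpruned. -/
def IsSettled (f : ℕ → α) (n : ℕ) (P per L : ℕ → ℕ) (e : ℕ) : Prop :=
  ∀ i < e, per i = i + 1 → i < L (P i) ∧
    ∀ q, start P i ≤ q → q < n → Larger f P per i q → L q ≤ i → f (P i) ≤ f q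

lemma IsSettled.congr {P' per' L' : ℕ → ℕ} (h : IsSettled f n P per L e)
    (hp : ∀ i < e, 0 < per i) (hP : ∀ i < e, P' i = P i)
    (hper : ∀ i < e, per' i = per i) (hPn : ∀ i < e, P i < n) (hL : ∀ q < n, L q ≤ L' q) :
    IsSettled f n P' per' L' e := by
  intro i hi hpi
  rw [hper i hi] at hpi
  obtain ⟨h1, h2⟩ := h i hi hpi
  rw [hP i hi, start_congr fun j hj => hP j (by omega)]
  refine ⟨h1.trans_le (hL _ (hPn i hi)), fun q h3 h4 h5 h6 => ?_⟩
  refine h2 q h3 h4 ?_ ((hL q h4).trans h6)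
  exact (Larger.congr (fun j hj => hp j (by omega)) (fun j hj => hP j (by omega))
    (fun j hj => hper j (by omega))).1 h5

lemma IsSettled.mono (h : IsSettled f n P per L e) {k : ℕ} (hk : k ≤ e) :
    IsSettled f n P per L k := fun i hi => h i (by omega)

lemma IsMaxStack.firstLarger (H : IsMaxStack f n P per next m e) {k : ℕ} (hk : k ≤ e) :
    IsFirstLarger f n P per k (next k) := by
  rcases Nat.lt_or_eq_of_le hk with h | rfl
  · exact H.stack.next k h
  · exact H.next_top

/-- The next visited word is larger than the current one. -/
lemma IsMaxStack.lt_child (H : IsMaxStack f n P per next m e) (hset : IsSettled f n P per L e)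
    {j b : ℕ} (hj : j ≤ e) (hb : IsChild f n P per L j b) {g : ℕ → α} (hg : ∀ i < j, g i = f (P i))
    (hgj : g j = f b) : word (fun i => f (P i)) m < word g (j + 1) := by
  rcases Nat.lt_or_ge j m with hjm | hjm
  · have hje : j < e := by have := H.le; omega
    refine word_lt_word.2 (Or.inr ⟨j, hjm, by omega, fun i hi => (hg i hi).symm, ?_⟩)
    rw [hgj]
    have hS := H.stack
    by_cases hper : per j = j + 1
    · obtain ⟨h1, h2⟩ := hset j hje hper
      refine lt_of_le_of_ne (h2 b hb.start_le hb.lt hb.larger hb.table) fun hc => ?_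
      have : b = P j := by
        rcases lt_trichotomy b (P j) with h | h | h
        · exact absurd hc.symm (hS.first j hje b hb.start_le h)
        · exact h
        · exact absurd hc (hb.first (P j) (hS.start_le j hje) h)
      have := hb.table
      subst b; omega
    · have h1 := hS.per_le j hje
      have h2 := hS.per_pos j hje
      have hjm' := hb.larger
      rcases hjm' with h | h
      · omega
      -- the stack symbol continues the period of the previous prefix
      · have h0 : 0 < j := by omega
        have e1 := hS.lyndon j hje
        have e2 := hS.period j hje j (by omega) le_rfl
        refine lt_of_le_of_lt ?_ h
        -- of two different Lyndon prefixes, the shorter one is not a period of the longer one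
        have hp1 := hS.per_pos (j - 1) (by omega)
        have hp2 := hS.per_le (j - 1) (by omega)
        have hl := hS.lyndon (j - 1) (by omega)
        have key : per j = per (j - 1) := by
          rcases lt_trichotomy (per j) (per (j - 1)) with hlt | heq | hgt
          · exact absurd (fun i h3 h4 => hS.period j hje i h3 (by omega))
              (hl.not_period h2 hlt)
          · exact heq
          · exact absurd (fun i h3 h4 => hS.period (j - 1) (by omega) i h3 (by omega))
              (e1.not_period hp1 hgt)
        rw [e2, key]
  · exact word_lt_word.2 (Or.inl ⟨by omega, fun i hi => (hg i (by omega)).symm⟩)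

/-- The stack after appending the symbol of a child. -/
lemma IsMaxStack.child_stack (H : IsMaxStack f n P per next m e) {j b : ℕ} (hj : j ≤ e)
    (hb : IsChild f n P per L j b) {P' per' next' : ℕ → ℕ} (hP : ∀ i < j, P' i = P i)
    (hper : ∀ i < j, per' i = per i) (hnext : ∀ i ≤ j, next' i = next i) (hPj : P' j = b)
    (hperj : per' j = j + 1) : IsStack f n P' per' next' (j + 1) := by
  have hS := (H.stack.mono hj).congr hP hper (fun i hi => hnext i (by omega))
  have hpp := (H.stack.mono hj).per_pos
  refine hS.push_larger ?_ ?_ ?_ hperj ?_ ?_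
  · rw [hPj]; exact hb.lt
  · rw [hPj, start_congr hP]; exact hb.start_le
  · rw [hPj, start_congr hP]; exact hb.first
  · rw [hPj]; exact (Larger.congr hpp hP hper).2 hb.larger
  · rw [hnext j le_rfl]; exact (H.firstLarger hj).congr hpp hP hper

lemma IsSettled.child (H : IsMaxStack f n P per next m e) (hset : IsSettled f n P per L e)
    {j b : ℕ} (hj : j ≤ e) (hb : IsChild f n P per L j b) {P' per' L' : ℕ → ℕ}
    (hP : ∀ i < j, P' i = P i) (hper : ∀ i < j, per' i = per i) (hPj : P' j = b)
    (hL : ∀ q < n, L q ≤ L' q) (hLb : j < L' b) : IsSettled f n P' per' L' (j + 1) := by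
  have hS := H.stack.mono hj
  have h1 := (hset.mono hj).congr hS.per_pos hP hper hS.lt hL
  intro i hi hpi
  rcases Nat.lt_succ_iff_lt_or_eq.1 hi with hi | rfl
  · exact h1 i hi hpi
  · rw [hPj]
    refine ⟨hLb, fun q h2 h3 h4 h5 => ?_⟩
    rw [start_congr hP] at h2
    exact hb.min q h2 h3 ((Larger.congr hS.per_pos hP hper).1 h4) ((hL q h3).trans h5)

lemma IsTable.update {w w' : List α} (h : IsTable f n L w) (hw : w ≤ w') (hw' : IsLyndon w')
    {b : ℕ} (hlen : w'.length ≤ n) (hsub : w'.Sublist ((word f n).take (b + 1))) {L' : ℕ → ℕ}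
    (hL : ∀ q < n, L' q = if b ≤ q ∧ L q < w'.length then w'.length else L q)
    (htop : L' n = n + 1) : IsTable f n L' w' := by
  have hle : ∀ q < n, L' q ≤ n := fun q hq => by
    have := h.le q hq
    rw [hL q hq]; split_ifs <;> omega
  refine ⟨fun q q' hqq hq' => ?_, htop, hle, fun q hq h0 => ?_⟩
  · rcases Nat.lt_or_eq_of_le hq' with hq' | rfl
    · have := h.mono q q' hqq hq'.le
      rw [hL q (by omega), hL q' hq']
      split_ifs <;> omega
    · rcases Nat.lt_or_eq_of_le hqq with hq | rfl
      · have := hle q hq; omega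
      · exact le_rfl
  · rw [hL q hq] at h0 ⊢
    split_ifs at h0 ⊢ with hc
    · refine ⟨w', hw', le_rfl, le_rfl, hsub.trans ?_⟩
      exact (List.take_prefix_take_left (by omega)).sublist
    · obtain ⟨v, h1, h2, h3, h4⟩ := h.witness q hq h0
      exact ⟨v, h1, h2.trans hw, h3, h4⟩

lemma IsBest.update {T B w w' : List α} (hB : IsBest T B w) (hw : w < w') (hw' : IsLyndon w')
    (hsub : w'.Sublist T)
    (hdom : ∀ v, IsLyndon v → v.Sublist T → v < w' → Dominates B v) :
    IsBest T (if B.length < w'.length then w' else B) w' := by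
  split_ifs with hlen
  · refine ⟨Or.inr ⟨hw', hsub⟩, le_rfl, fun v h1 h2 h3 => ?_⟩
    rcases lt_or_eq_of_le h3 with h4 | rfl
    · rcases hdom v h1 h2 h4 with h5 | h5
      · exact Or.inl (by omega)
      · exact Or.inl (by omega)
    · exact Or.inr ⟨rfl, le_rfl⟩
  · refine ⟨hB.eq_nil_or, hB.le.trans hw.le, fun v h1 h2 h3 => ?_⟩
    rcases lt_or_eq_of_le h3 with h4 | rfl
    · exact hdom v h1 h2 h4
    · rcases Nat.lt_or_ge v.length B.length with h5 | h5
      · exact Or.inl h5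
      · exact Or.inr ⟨by omega, hB.le.trans hw.le⟩

/-- A string that dominates all Lyndon subsequences is the one sought. -/
lemma IsBest.isLeast {T B w : List α} (hT : T ≠ []) (hB : IsBest T B w)
    (hdom : ∀ v, IsLyndon v → v.Sublist T → Dominates B v) : IsLeastLongestLyndonSubseq T B := by
  obtain ⟨c, y, rfl⟩ := List.exists_cons_of_ne_nil hT
  have hc : IsLyndon [c] := by
    have : [c] = word (fun _ => c) 1 := by simp [word]
    rw [this, isLyndon_word]
    exact ⟨by omega, fun r h1 h2 => by omega⟩
  have hne : B ≠ [] := by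
    rintro rfl
    rcases hdom [c] hc (by simp) with h | h <;> simp at h
  obtain ⟨h1, h2⟩ := hB.eq_nil_or.resolve_left hne
  refine ⟨⟨h2, h1, fun S' h3 h4 => ?_⟩, fun S' h3 => ?_⟩
  · rcases hdom S' h4 h3 with h | h <;> omega
  · rcases hdom S' h3.2.1 h3.1 with h | h
    · have := h3.2.2 B h2 h1; omega
    · exact h.2

/-! ### Periodic continuation -/

/-- `g` is the first position after `i` that holds a larger symbol, and is `n` if there is none. -/
structure IsNextGreater (f : ℕ → α) (n i g : ℕ) : Prop where
  lt : i < g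
  le : g ≤ n
  larger : g < n → f i < f g
  not_larger : ∀ q, i < q → q < g → ¬ f i < f q

/-- The continuation of the Lyndon word of length `J` has reached `k` symbols, and the symbol number
`k` is being sought at position `q`. The number `x` is the first position scanned with a larger
symbol, and is `n` if there is none. -/
structure IsExtending (f : ℕ → α) (n : ℕ) (P per next L : ℕ → ℕ) (J k q x : ℕ) : Prop where
  stack : IsStack f n P per next k
  settled : IsSettled f n P per L k
  pos : 0 < J
  le : J ≤ k
  per_eq : ∀ i < k, J ≤ i + 1 → per i = J
  start_le : start P k ≤ q
  le_n : q ≤ n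
  ne : ∀ i, start P k ≤ i → i < q → f i ≠ f (P (k - J))
  larger : (x = n ∧ ∀ i, start P k ≤ i → i < q → ¬ f (P (k - J)) < f i) ∨
    (x < q ∧ IsFirstLarger f n P per k x)

namespace IsExtending

variable {J k q x : ℕ}

lemma larger_iff (h : IsExtending f n P per next L J k q x) {i : ℕ} :
    Larger f P per k i ↔ f (P (k - J)) < f i := by
  have h1 := h.pos
  have h2 := h.le
  unfold Larger
  rw [h.per_eq (k - 1) (by omega) (by omega)]
  exact or_iff_right (by omega)

lemma skip (h : IsExtending f n P per next L J k q x) (hq : q < n) (hlt : f q < f (P (k - J))) :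
    IsExtending f n P per next L J k (q + 1) x where
  stack := h.stack
  settled := h.settled
  pos := h.pos
  le := h.le
  per_eq := h.per_eq
  start_le := h.start_le.trans (Nat.le_succ q)
  le_n := hq
  ne i h1 h2 := by
    rcases Nat.lt_succ_iff_lt_or_eq.1 h2 with h2 | rfl
    · exact h.ne i h1 h2
    · exact hlt.ne
  larger := by
    rcases h.larger with ⟨h1, h2⟩ | ⟨h1, h2⟩
    · refine Or.inl ⟨h1, fun i h3 h4 => ?_⟩
      rcases Nat.lt_succ_iff_lt_or_eq.1 h4 with h4 | rfl
      · exact h2 i h3 h4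
      · exact hlt.not_gt
    · exact Or.inr ⟨by omega, h2⟩

lemma found (h : IsExtending f n P per next L J k q x) (hq : q < n) (hlt : f (P (k - J)) < f q) :
    IsExtending f n P per next L J k (q + 1) (if x = n then q else x) where
  stack := h.stack
  settled := h.settled
  pos := h.pos
  le := h.le
  per_eq := h.per_eq
  start_le := h.start_le.trans (Nat.le_succ q)
  le_n := hq
  ne i h1 h2 := by
    rcases Nat.lt_succ_iff_lt_or_eq.1 h2 with h2 | rfl
    · exact h.ne i h1 h2
    · exact hlt.ne'
  larger := by
    rcases h.larger with ⟨h1, h2⟩ | ⟨h1, h2⟩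
    · rw [if_pos h1]
      exact Or.inr ⟨by omega, h.start_le, hq.le, fun _ => h.larger_iff.2 hlt,
        fun i h3 h4 h5 => h2 i h3 h4 (h.larger_iff.1 h5)⟩
    · rw [if_neg (by have := h.le_n; omega)]
      exact Or.inr ⟨by omega, h2⟩

/-- If no larger symbol precedes the occurrence of the sought symbol, then the first larger symbol
is the next greater one of this occurrence. -/
lemma push (h : IsExtending f n P per next L J k q x) (hq : q < n) (heq : f q = f (P (k - J)))
    {g : ℕ} (hg : IsNextGreater f n q g) {P' per' next' : ℕ → ℕ} (hP : ∀ i < k, P' i = P i)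
    (hper : ∀ i < k, per' i = per i) (hnext : ∀ i < k, next' i = next i) (hPk : P' k = q)
    (hperk : per' k = J) (hnextk : next' k = if x = n then g else x) :
    IsExtending f n P' per' next' L J (k + 1) (q + 1) n := by
  have hJ := h.pos
  have hJk := h.le
  have hpp := h.stack.per_pos
  have hS := h.stack.congr hP hper hnext
  have hst : start P' k = start P k := start_congr hP
  have hstack : IsStack f n P' per' next' (k + 1) := by
    refine hS.push_equal (by omega) ?_ ?_ ?_ ?_ ?_ ?_
    · rw [hPk]; exact hq
    · rw [hPk, hst]; exact h.start_le
    · rw [hPk, hst, heq]; exact h.ne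
    · rw [hperk, hper _ (by omega), h.per_eq _ (by omega) (by omega)]
    · rw [hPk, hperk, hP _ (by omega), heq]
    · rw [hnextk]
      refine IsFirstLarger.congr (P := P) (per := per) ?_ hpp hP hper
      rcases h.larger with ⟨h1, h2⟩ | ⟨h1, h2⟩
      · rw [if_pos h1]
        have hsl := h.start_le
        refine ⟨by have := hg.lt; omega, hg.le, fun h3 => ?_, fun i h3 h4 h5 => ?_⟩
        · rw [h.larger_iff, ← heq]; exact hg.larger h3
        · rw [h.larger_iff] at h5
          rcases lt_trichotomy i q with h6 | rfl | h6
          · exact h2 i h3 h6 h5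
          · rw [heq] at h5; exact lt_irrefl _ h5
          · rw [← heq] at h5; exact hg.not_larger i h6 h4 h5
      · rw [if_neg (by have := h.le_n; omega)]; exact h2
  refine ⟨hstack, ?_, hJ, by omega, ?_, ?_, hq, ?_, Or.inl ⟨rfl, ?_⟩⟩
  · have h1 := h.settled.congr (P' := P') (per' := per') (L' := L) hpp hP hper h.stack.lt
      (fun _ _ => le_rfl)
    intro i hi hpi
    rcases Nat.lt_succ_iff_lt_or_eq.1 hi with hi | rfl
    · exact h1 i hi hpi
    · omega
  · intro i hi h1
    rcases Nat.lt_succ_iff_lt_or_eq.1 hi with hi | rfl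
    · rw [hper i hi]; exact h.per_eq i hi h1
    · exact hperk
  · simp [start, hPk]
  · intro i h1 h2; simp only [start, hPk] at h1; omega
  · intro i h1 h2; simp only [start, hPk] at h1; omega

lemma isMaxStack (h : IsExtending f n P per next L J k n x) {P' per' next' : ℕ → ℕ}
    (hP : ∀ i < k, P' i = P i) (hper : ∀ i < k, per' i = per i) (hnext : ∀ i < k, next' i = next i)
    (hnextk : next' k = x) : IsMaxStack f n P' per' next' J k where
  stack := h.stack.congr hP hper hnext
  next_top := by
    rw [hnextk]
    refine IsFirstLarger.congr (P := P) (per := per) ?_ h.stack.per_pos hP hper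
    rcases h.larger with ⟨h1, h2⟩ | ⟨h1, h2⟩
    · subst h1
      exact ⟨h.start_le, le_rfl, fun h3 => absurd h3 (lt_irrefl _),
        fun i h3 h4 h5 => h2 i h3 h4 (h.larger_iff.1 h5)⟩
    · exact h2
  le := h.le
  pos := Or.inl h.pos
  per_eq i hi h1 := by rw [hper i hi]; exact h.per_eq i hi h1
  maximal h0 q h1 h2 := by
    have h3 := h.le
    have h4 := h.pos
    rw [hper _ (by omega), h.per_eq (k - 1) (by omega) (by omega), hP _ (by omega)]
    rw [start_congr hP] at h1
    exact h.ne q h1 h2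

end IsExtending

end Transition

/-! ### Program verification -/

namespace WordRAM

section Verification

variable {α : Type*} [LinearOrder α]

/-- The positions compared by a test are positions of an input of length `n`. -/
@[simp] def Test.Safe (n : ℕ) (r : ℕ → ℕ) : Test → Prop
  | .lt _ _ => True
  | .eq _ _ => True
  | .symLt a b => r a < n ∧ r b < n

/-- The test succeeds on registers with values `r`. -/
@[simp] def Test.Holds (f : ℕ → α) (r : ℕ → ℕ) : Test → Prop
  | .lt a b => r a < r b
  | .eq a b => r a = r b
  | .symLt a b => f (r a) < f (r b)

/-- A weakest-precondition calculus on natural-number values `r` of the registers and `m` of the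
memory: `wp f n M P Q r m` implies that `P`, started with these values on the input
`f 0, …, f (n - 1)`, halts with a running time and final values that satisfy `Q`. Of the arithmetic
operations it covers additions and subtractions that do not overflow. A loop needs an invariant `I`
and a potential `φ` that pays for the steps. -/
def wp (f : ℕ → α) (n M : ℕ) :
    Prog → (ℕ → (ℕ → ℕ) → (ℕ → ℕ) → Prop) → (ℕ → ℕ) → (ℕ → ℕ) → Prop
  | .skip, Q, r, m => Q 1 r m
  | .const d k, Q, r, m => k < M ∧ Q 1 (Function.update r d k) m
  | .op .add d a b, Q, r, m => r a + r b < M ∧ Q 1 (Function.update r d (r a + r b)) m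
  | .op .sub d a b, Q, r, m => r b ≤ r a ∧ Q 1 (Function.update r d (r a - r b)) m
  | .op _ _ _ _, _, _, _ => False
  | .load d a, Q, r, m => r a < M ∧ Q 1 (Function.update r d (m (r a))) m
  | .store a b, Q, r, m => r a < M ∧ Q 1 r (Function.update m (r a) (r b))
  | .seq P P', Q, r, m =>
      wp f n M P (fun t r m => wp f n M P' (fun t' r m => Q (t + t') r m) r m) r m
  | .cond c P P', Q, r, m => c.Safe n r ∧
      (c.Holds f r → wp f n M P (fun t r m => Q (t + 1) r m) r m) ∧
      (¬ c.Holds f r → wp f n M P' (fun t r m => Q (t + 1) r m) r m)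
  | .loop c P, Q, r, m => ∃ (I : (ℕ → ℕ) → (ℕ → ℕ) → Prop) (φ : (ℕ → ℕ) → (ℕ → ℕ) → ℕ), I r m ∧
      ∀ r' m', I r' m' → c.Safe n r' ∧
        (c.Holds f r' →
          wp f n M P (fun t r'' m'' => I r'' m'' ∧ t + 1 + φ r'' m'' ≤ φ r' m') r' m') ∧
        (¬ c.Holds f r' → ∀ t, t + φ r' m' ≤ φ r m + 1 → Q t r' m')

section Rules

variable {f : ℕ → α} {n M : ℕ} {Q : ℕ → (ℕ → ℕ) → (ℕ → ℕ) → Prop} {r m : ℕ → ℕ}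

@[simp] lemma wp_skip : wp f n M .skip Q r m ↔ Q 1 r m := Iff.rfl

@[simp] lemma wp_const {d k : ℕ} :
    wp f n M (.const d k) Q r m ↔ k < M ∧ Q 1 (Function.update r d k) m := Iff.rfl

@[simp] lemma wp_add {d a b : ℕ} : wp f n M (.op .add d a b) Q r m ↔
    r a + r b < M ∧ Q 1 (Function.update r d (r a + r b)) m := Iff.rfl

@[simp] lemma wp_sub {d a b : ℕ} : wp f n M (.op .sub d a b) Q r m ↔
    r b ≤ r a ∧ Q 1 (Function.update r d (r a - r b)) m := Iff.rfl

@[simp] lemma wp_load {d a : ℕ} : wp f n M (.load d a) Q r m ↔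
    r a < M ∧ Q 1 (Function.update r d (m (r a))) m := Iff.rfl

@[simp] lemma wp_store {a b : ℕ} : wp f n M (.store a b) Q r m ↔
    r a < M ∧ Q 1 r (Function.update m (r a) (r b)) := Iff.rfl

@[simp] lemma wp_seq {P P' : Prog} : wp f n M (.seq P P') Q r m ↔
    wp f n M P (fun t r m => wp f n M P' (fun t' r m => Q (t + t') r m) r m) r m := Iff.rfl

@[simp] lemma wp_cond {c : Test} {P P' : Prog} : wp f n M (.cond c P P') Q r m ↔ c.Safe n r ∧
    (c.Holds f r → wp f n M P (fun t r m => Q (t + 1) r m) r m) ∧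
    (¬ c.Holds f r → wp f n M P' (fun t r m => Q (t + 1) r m) r m) := Iff.rfl

lemma wp_loop {c : Test} {P : Prog} (I : (ℕ → ℕ) → (ℕ → ℕ) → Prop)
    (φ : (ℕ → ℕ) → (ℕ → ℕ) → ℕ) (hI : I r m)
    (hsafe : ∀ r' m', I r' m' → c.Safe n r')
    (hstep : ∀ r' m', I r' m' → c.Holds f r' →
      wp f n M P (fun t r'' m'' => I r'' m'' ∧ t + 1 + φ r'' m'' ≤ φ r' m') r' m')
    (hQ : ∀ t r' m', I r' m' → ¬ c.Holds f r' → t + φ r' m' ≤ φ r m + 1 → Q t r' m') :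
    wp f n M (.loop c P) Q r m :=
  ⟨I, φ, hI, fun r' m' h => ⟨hsafe r' m' h, hstep r' m' h, fun hc t => hQ t r' m' h hc⟩⟩

end Rules

lemma wp_mono {f : ℕ → α} {n M : ℕ} {P : Prog} {Q Q' : ℕ → (ℕ → ℕ) → (ℕ → ℕ) → Prop}
    {r m : ℕ → ℕ} (h : wp f n M P Q r m) (hQ : ∀ t r m, Q t r m → Q' t r m) :
    wp f n M P Q' r m := by
  induction P generalizing Q Q' r m with
  | skip => exact hQ _ _ _ h
  | const d k => exact ⟨h.1, hQ _ _ _ h.2⟩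
  | op o d a b => cases o <;> first | exact ⟨h.1, hQ _ _ _ h.2⟩ | exact h
  | load d a => exact ⟨h.1, hQ _ _ _ h.2⟩
  | store a b => exact ⟨h.1, hQ _ _ _ h.2⟩
  | seq P P' ih ih' => exact ih h fun t r m h => ih' h fun t' r m h => hQ _ _ _ h
  | cond c P P' ih ih' =>
    exact ⟨h.1, fun hc => ih (h.2.1 hc) fun t r m h => hQ _ _ _ h,
      fun hc => ih' (h.2.2 hc) fun t r m h => hQ _ _ _ h⟩
  | loop c P ih =>
    obtain ⟨I, φ, h0, h⟩ := h
    exact ⟨I, φ, h0, fun r' m' hI => ⟨(h r' m' hI).1, (h r' m' hI).2.1,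
      fun hc t ht => hQ _ _ _ ((h r' m' hI).2.2 hc t ht)⟩⟩

/-- The registers and the memory of `s` hold the numbers `r` and `m`. -/
def State.Holds {w : ℕ} (s : State w) (r m : ℕ → ℕ) : Prop :=
  (∀ i, (s.reg i).toNat = r i) ∧ ∀ i, (s.mem i).toNat = m i

lemma State.Holds.setReg {w : ℕ} {s : State w} {r m : ℕ → ℕ} (h : s.Holds r m) (d : ℕ)
    {x : BitVec w} {k : ℕ} (hx : x.toNat = k) :
    State.Holds { s with reg := Function.update s.reg d x } (Function.update r d k) m := by
  refine ⟨fun i => ?_, h.2⟩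
  by_cases hi : i = d
  · subst hi; simp [hx]
  · simp [Function.update_of_ne hi, h.1 i]

lemma Test.eval_eq {f : ℕ → α} {n w : ℕ} {s : State w} {r m : ℕ → ℕ} (h : s.Holds r m) {c : Test}
    (hc : c.Safe n r) : (c.Holds f r → c.eval (word f n) s = some true) ∧
      (¬ c.Holds f r → c.eval (word f n) s = some false) := by
  cases c with
  | lt a b => simp [Test.eval, Test.Holds, h.1]
  | eq a b => simp [Test.eval, Test.Holds, ← h.1, BitVec.toNat_inj]
  | symLt a b =>
    obtain ⟨h1, h2⟩ := hc
    have e : ∀ i, i < n → (word f n)[i]? = some (f i) := fun i hi => by simp [word, hi]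
    simp [Test.eval, Test.Holds, h.1, e _ h1, e _ h2]

theorem wp_sound {f : ℕ → α} {n M w : ℕ} (hM : M ≤ 2 ^ w) {P : Prog}
    {Q : ℕ → (ℕ → ℕ) → (ℕ → ℕ) → Prop} {r m : ℕ → ℕ} (h : wp f n M P Q r m) {s : State w}
    (hs : s.Holds r m) :
    ∃ t s' r' m', Exec (word f n) M P s t s' ∧ s'.Holds r' m' ∧ Q t r' m' := by
  induction P generalizing Q r m s with
  | skip => exact ⟨_, _, _, _, .skip s, hs, h⟩
  | const d k =>
    exact ⟨_, _, _, _, .const d k s,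
      hs.setReg d (by rw [BitVec.toNat_ofNat, Nat.mod_eq_of_lt (h.1.trans_le hM)]), h.2⟩
  | op o d a b =>
    cases o with
    | add =>
      refine ⟨_, _, _, _, .op .add d a b s, hs.setReg d ?_, h.2⟩
      simp only [BinOp.eval, BitVec.toNat_add, hs.1]
      exact Nat.mod_eq_of_lt (h.1.trans_le hM)
    | sub =>
      refine ⟨_, _, _, _, .op .sub d a b s, hs.setReg d ?_, h.2⟩
      have : s.reg b ≤ s.reg a := by rw [BitVec.le_def, hs.1, hs.1]; exact h.1
      simp only [BinOp.eval]
      rw [BitVec.toNat_sub_of_le this, hs.1, hs.1]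
    | _ => exact h.elim
  | load d a =>
    refine ⟨_, _, _, _, .load d a s (by rw [hs.1]; exact h.1), hs.setReg d ?_, h.2⟩
    rw [hs.2, hs.1]
  | store a b =>
    refine ⟨_, _, _, _, .store a b s (by rw [hs.1]; exact h.1), ⟨hs.1, fun i => ?_⟩, h.2⟩
    by_cases hi : i = r a
    · subst hi; simp [hs.1]
    · simp [hs.1, Function.update_of_ne hi, hs.2]
  | seq P P' ih ih' =>
    obtain ⟨t₁, s₁, r₁, m₁, e₁, hs₁, h₁⟩ := ih h hs
    obtain ⟨t₂, s₂, r₂, m₂, e₂, hs₂, h₂⟩ := ih' h₁ hs₁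
    exact ⟨_, _, _, _, .seq e₁ e₂, hs₂, h₂⟩
  | cond c P P' ih ih' =>
    by_cases hc : c.Holds f r
    · obtain ⟨t, s', r', m', e, hs', hq⟩ := ih (h.2.1 hc) hs
      exact ⟨_, _, _, _, .cond_true ((Test.eval_eq hs h.1).1 hc) e, hs', hq⟩
    · obtain ⟨t, s', r', m', e, hs', hq⟩ := ih' (h.2.2 hc) hs
      exact ⟨_, _, _, _, .cond_false ((Test.eval_eq hs h.1).2 hc) e, hs', hq⟩
  | loop c P ih =>
    obtain ⟨I, φ, h0, h⟩ := h
    -- the potential decreases in each round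
    have key : ∀ N r' m' (s : State w), s.Holds r' m' → I r' m' → φ r' m' = N →
        ∃ t s' r'' m'', Exec (word f n) M (.loop c P) s t s' ∧ s'.Holds r'' m'' ∧ I r'' m'' ∧
          ¬ c.Holds f r'' ∧ t + φ r'' m'' ≤ φ r' m' + 1 := by
      intro N
      induction N using Nat.strong_induction_on with
      | _ N ihN =>
        intro r' m' s hs hI hN
        obtain ⟨hsafe, hstep, -⟩ := h r' m' hI
        by_cases hc : c.Holds f r'
        · obtain ⟨t₁, s₁, r₁, m₁, e₁, hs₁, hI₁, hφ⟩ := ih (hstep hc) hs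
          obtain ⟨t₂, s₂, r₂, m₂, e₂, hs₂, hI₂, hc₂, ht₂⟩ :=
            ihN (φ r₁ m₁) (by omega) r₁ m₁ s₁ hs₁ hI₁ rfl
          exact ⟨_, _, _, _, .loop_true ((Test.eval_eq hs hsafe).1 hc) e₁ e₂, hs₂, hI₂, hc₂,
            by omega⟩
        · exact ⟨_, _, _, _, .loop_false ((Test.eval_eq hs hsafe).2 hc), hs, hI, hc, by omega⟩
    obtain ⟨t, s', r', m', e, hs', hI, hc, ht⟩ := key _ r m s hs h0 rfl
    exact ⟨t, s', r', m', e, hs', (h r' m' hI).2.2 hc t ht⟩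

end Verification

end WordRAM

/-! ### The program -/

namespace WordRAM

local infixr:60 ";;" => Prog.seq

/-! Registers: 0 holds the input length `n` (and the output length in the end), 1 holds one, 2 holds
zero, 4 to 7 hold the addresses of the arrays below, 8 the length of the best word, 9 the number of
symbols of the next word (zero if there is none), 10 a table entry, 11 the scanned position, 12 the
position of the last symbol of the next word, 13 the position of the symbol continuing the
period, 14 an index into the stack, 15 the period, 16 and 17 intermediate values, 18 the first
position with a larger symbol. The offset `n` is also read from register 0.

Memory: the output at address `0`, the next greater positions at `n`, the stack at `2 * n`, its
periods at `3 * n`, its table of first larger positions at `4 * n` (with `n + 1` entries), and the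
table of pruning lengths at `6 * n` (with `n + 1` entries). -/

/-- Copy register `a` to register `d`. -/
def mov (d a : ℕ) : Prog := .op .add d a 2

/-- Load entry number `i` (a register) of the array whose address is in register `off` into register
`d`. -/
def ld (d off i : ℕ) : Prog := .op .add 16 off i ;; .load d 16

/-- Store register `v` to entry number `i` (a register) of the array whose address is in register
`off`. -/
def st (off i v : ℕ) : Prog := .op .add 16 off i ;; .store 16 v

/-- Find the next greater position of the one in register 11, scanning from the right. -/
def greaterLoop : Prog :=
  .loop (.lt 17 14) (.op .sub 14 14 1 ;; .cond (.symLt 11 14) (mov 18 14) .skip)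

/-- Tabulate the next greater positions. -/
def greater : Prog :=
  .loop (.lt 11 0)
    (mov 18 0 ;; mov 14 0 ;; .op .add 17 11 1 ;; greaterLoop ;; st 0 11 18 ;; .op .add 11 11 1)

/-- Set up the constants, the sentinel of the table of pruning lengths, and the next greater
positions. The first word has one symbol. -/
def init : Prog :=
  .const 1 1 ;; .op .add 4 0 0 ;; .op .add 5 4 0 ;; .op .add 6 4 4 ;; .op .add 7 6 4 ;;
  .op .add 17 0 1 ;; st 7 0 17 ;; greater ;; .const 9 1

/-- Scan the unpruned positions for the smallest symbol larger than the one continuing the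
period. -/
def chooseLoop : Prog :=
  .loop (.lt 10 9)
    (.cond (.symLt 11 12)
      (.cond (.eq 14 2) (mov 12 11) (.cond (.symLt 13 11) (mov 12 11) .skip)) .skip ;;
    .op .add 11 11 1 ;; ld 10 7 11)

/-- Choose the last symbol of the next word. -/
def choose : Prog :=
  .op .sub 14 9 1 ;; ld 12 6 14 ;; mov 11 12 ;;
  .cond (.eq 14 2) .skip
    (.op .sub 17 14 1 ;; ld 15 5 17 ;; .op .sub 17 14 15 ;; ld 13 4 17) ;;
  ld 10 7 11 ;; chooseLoop

/-- Push the chosen symbol and raise the pruning lengths to the length of the new word. -/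
def settle : Prog :=
  st 4 14 12 ;; st 5 14 9 ;; mov 11 12 ;; ld 10 7 11 ;;
  .loop (.lt 10 9) (st 7 11 9 ;; .op .add 11 11 1 ;; ld 10 7 11)

/-- Copy the new word to the output if it is longer than the best one so far. -/
def record : Prog :=
  .cond (.lt 8 9)
    (mov 8 9 ;; mov 14 2 ;;
      .loop (.lt 14 9) (ld 17 4 14 ;; .store 14 17 ;; .op .add 14 14 1)) .skip

/-- Scan the rest of the input for the longest periodic continuation, recording the first larger
positions. In register 18, the value `n` says that no larger symbol has been met yet. -/
def extendLoop : Prog :=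
  .loop (.lt 11 0)
    (.cond (.symLt 13 11) (.cond (.eq 18 0) (mov 18 11) .skip)
      (.cond (.symLt 11 13) .skip
        (.cond (.eq 18 0) (ld 18 0 11) .skip ;;
          st 6 14 18 ;; st 4 14 11 ;; st 5 14 15 ;;
          .op .add 14 14 1 ;; mov 18 0 ;; .op .sub 17 14 15 ;; ld 13 4 17)) ;;
      .op .add 11 11 1)

/-- Extend the stack from the new word to its longest periodic continuation. -/
def extend : Prog :=
  mov 14 9 ;; mov 15 9 ;; .op .add 11 12 1 ;; mov 18 0 ;; ld 13 4 2 ;; extendLoop ;; st 6 14 18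

/-- Find the largest number of stack symbols after which the stack can be left for an unpruned word,
and put the length of this word into register 9, or zero if there is none. Register 10 holds one more
than the table entry to be compared with this length, and zero ends the search. -/
def search : Prog :=
  .op .add 9 14 1 ;; ld 10 7 18 ;; .op .add 10 10 1 ;;
  .loop (.lt 9 10)
    (.op .sub 9 9 1 ;;
      .cond (.eq 9 2) (.const 10 0)
        (.op .sub 17 9 1 ;; ld 18 6 17 ;; ld 10 7 18 ;; .op .add 10 10 1))

/-- One round of the main loop: visit the next word. -/
def round : Prog := choose ;; settle ;; record ;; extend ;; search

/-- The program computing the smallest longest Lyndon subsequence. -/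
def lyndonProg : Prog := init ;; .loop (.lt 2 9) round ;; mov 0 8

/-! ### Correctness and running time of the program -/

/-- The constants held by registers. -/
def Consts (n : ℕ) (r : ℕ → ℕ) : Prop :=
  r 0 = n ∧ r 1 = 1 ∧ r 2 = 0 ∧ r 4 = 2 * n ∧ r 5 = 3 * n ∧ r 6 = 4 * n ∧ r 7 = 6 * n

section Spec

variable {α : Type*} [LinearOrder α] {f : ℕ → α} {n M e ml : ℕ} {r m : ℕ → ℕ} {w : List α}

lemma wp_settle (hM : 8 * n + 8 ≤ M) (hc : Consts n r)
    (HL : IsTable f n (fun i => m (6 * n + i)) w) (hb : r 12 < n) (hj : r 14 < n)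
    (hJ : r 9 ≤ n) :
    wp f n M settle (fun t r' m' => Consts n r' ∧ r' 8 = r 8 ∧ r' 9 = r 9 ∧ r' 12 = r 12 ∧
      (∀ a < 6 * n, m' a =
        if a = 3 * n + r 14 then r 9 else if a = 2 * n + r 14 then r 12 else m a) ∧
      (∀ q ≤ n, m' (6 * n + q) =
        if r 12 ≤ q ∧ m (6 * n + q) < r 9 then r 9 else m (6 * n + q)) ∧
      t ≤ 20 * (n + 1)) r m := by
  have hc' := hc
  obtain ⟨h0, h1, h2, h4, h5, h6, h7⟩ := hc'
  have htop := HL.top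
  simp [settle, st, ld, mov, Function.update_apply, h2, h4, h5, h7]
  refine ⟨by omega, by omega, by omega, by omega, ?_⟩
  refine wp_loop (fun r' m' => Consts n r' ∧ r' 8 = r 8 ∧ r' 9 = r 9 ∧ r' 12 = r 12 ∧ r 12 ≤ r' 11 ∧
      r' 11 ≤ n ∧ r' 10 = m (6 * n + r' 11) ∧
      (∀ q, r 12 ≤ q → q < r' 11 → m (6 * n + q) < r 9) ∧
      (∀ a < 6 * n, m' a =
        if a = 3 * n + r 14 then r 9 else if a = 2 * n + r 14 then r 12 else m a) ∧
      (∀ q ≤ n, m' (6 * n + q) = if r 12 ≤ q ∧ q < r' 11 then r 9 else m (6 * n + q)))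
    (fun r' _ => 10 * (n - r' 11)) ?_ ?_ ?_ ?_
  · simp [Function.update_apply, Consts, h0, h1, h2, h4, h5, h6, h7]
    refine ⟨by omega, ?_, fun q h1 h2 => by omega, fun q hq => ?_⟩
    · rw [if_neg (by omega), if_neg (by omega)]
    · rw [if_neg (by omega), if_neg (by omega), if_neg (by omega)]
  · simp
  · rintro r' m' ⟨⟨h0', h1', h2', h4', h5', h6', h7'⟩, e8, e9, e12, hle, hn, e10, hlt, hlow,
      htab⟩ hc
    simp at hc
    simp [Function.update_apply, Consts, h0', h1', h2', h4', h5', h6', h7']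
    have hlt' : r' 11 < n := by
      refine lt_of_le_of_ne hn fun h => ?_
      rw [h] at e10; omega
    refine ⟨by omega, by omega, by omega, ⟨e8, e9, e12, by omega, hlt', ?_, ?_, ?_, ?_⟩, by omega⟩
    · rw [htab _ (by omega), if_neg (by omega)]
    · intro q h1 h2
      rcases Nat.lt_or_eq_of_le h2 with h2 | rfl
      · exact hlt q h1 h2
      · omega
    · intro a ha
      rw [if_neg (by omega)]; exact hlow a ha
    · intro q hq
      rw [htab q hq, e9]
      split_ifs <;> omega
  · rintro t r' m' ⟨hcs, e8, e9, e12, hle, hn, e10, hlt, hlow, htab⟩ hc ht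
    simp at hc
    simp at ht
    refine ⟨hcs, e8, e9, e12, hlow, ?_, ?_⟩
    · intro q hq
      rw [htab q hq]
      have h1 := hlt q
      have h2 := HL.mono (r' 11) q
      split_ifs <;> omega
    · omega

/-- The scan for a child from the first candidate on, with register 13 holding the position of the
symbol that continues the period. -/
lemma wp_chooseLoop (hM : 8 * n + 8 ≤ M) (hc : Consts n r)
    (H : IsMaxStack f n (fun i => m (2 * n + i)) (fun i => m (3 * n + i)) (fun i => m (4 * n + i))
      ml e)
    (HL : IsTable f n (fun i => m (6 * n + i)) w) {J : ℕ} (hr9 : r 9 = J) (hJ : 0 < J)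
    (hJe : J ≤ e + 1) (hr14 : r 14 = J - 1)
    (hF : IsFirstLarger f n (fun i => m (2 * n + i)) (fun i => m (3 * n + i)) (J - 1) (r 12))
    (hlt : r 12 < n) (hL : m (6 * n + r 12) < J) (hr11 : r 11 = r 12)
    (hr10 : r 10 = m (6 * n + r 11))
    (hr13 : J - 1 ≠ 0 → r 13 = m (2 * n + (J - 1 - m (3 * n + (J - 1 - 1))))) :
    wp f n M chooseLoop (fun t r' m' => m' = m ∧ Consts n r' ∧ r' 8 = r 8 ∧ r' 9 = J ∧
      r' 14 = J - 1 ∧ IsChild f n (fun i => m (2 * n + i)) (fun i => m (3 * n + i))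
        (fun i => m (6 * n + i)) (J - 1) (r' 12) ∧ t ≤ 10 * n + 1) r m := by
  have htop := HL.top
  have hen : e ≤ n := (H.stack.le_start e le_rfl).trans (H.stack.start_le_n e le_rfl)
  have hFs := hF.start_le
  refine wp_loop (fun r' m' => m' = m ∧ Consts n r' ∧ r' 8 = r 8 ∧ r' 9 = J ∧ r' 14 = J - 1 ∧
    r' 13 = r 13 ∧ r' 10 = m (6 * n + r' 11) ∧ r 12 ≤ r' 11 ∧ r' 11 ≤ n ∧
    r' 12 ≤ r' 11 ∧ r' 12 < n ∧ start (fun i => m (2 * n + i)) (J - 1) ≤ r' 12 ∧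
    Larger f (fun i => m (2 * n + i)) (fun i => m (3 * n + i)) (J - 1) (r' 12) ∧
    (∀ q, start (fun i => m (2 * n + i)) (J - 1) ≤ q → q < r' 12 → f q ≠ f (r' 12)) ∧
    m (6 * n + r' 12) < J ∧
    (∀ q, start (fun i => m (2 * n + i)) (J - 1) ≤ q → q < r' 11 →
      Larger f (fun i => m (2 * n + i)) (fun i => m (3 * n + i)) (J - 1) q → f (r' 12) ≤ f q))
    (fun r' _ => 10 * (n - r' 11)) ?_ ?_ ?_ ?_
  · refine ⟨rfl, hc, rfl, hr9, hr14, rfl, hr10, hr11.ge, by omega, hr11.ge, hlt, hF.start_le,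
      hF.larger hlt, fun q h1 h2 h3 => ?_, hL, fun q h1 h2 h3 => ?_⟩
    · refine hF.not_larger q h1 h2 ?_
      rcases hF.larger hlt with h | h
      · exact Or.inl h
      · exact Or.inr (by rw [h3]; exact h)
    · exact absurd h3 (hF.not_larger q h1 (by omega))
  · simp
  · rintro r' m' ⟨rfl, ⟨h0', h1', h2', h4', h5', h6', h7'⟩, e8, e9, e14, e13, e10, hle, hn, hbq,
      hbn, hsb, hlb, hfb, hLb, hmin⟩ hc
    simp at hc
    have hqn : r' 11 < n := by
      refine lt_of_le_of_ne hn fun h => ?_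
      rw [h] at e10; omega
    have hLq : m' (6 * n + r' 11) < J := by omega
    have h13 : J - 1 ≠ 0 → r' 13 < n := fun h => by
      rw [e13, hr13 h]
      have h1 := H.stack.per_pos (J - 1 - 1) (by omega)
      exact H.stack.lt _ (by omega)
    have hlq : Larger f (fun i => m' (2 * n + i)) (fun i => m' (3 * n + i)) (J - 1) (r' 11) ↔
        (J - 1 = 0 ∨ f (r' 13) < f (r' 11)) := by
      unfold Larger
      by_cases h : J - 1 = 0
      · simp [h]
      · rw [e13, hr13 h]
    -- a smaller symbol than the best one is its own first occurrence
    have hnew : f (r' 11) < f (r' 12) →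
        Larger f (fun i => m' (2 * n + i)) (fun i => m' (3 * n + i)) (J - 1) (r' 11) →
        (∀ q, start (fun i => m' (2 * n + i)) (J - 1) ≤ q → q < r' 11 → f q ≠ f (r' 11)) ∧
        ∀ q, start (fun i => m' (2 * n + i)) (J - 1) ≤ q → q ≤ r' 11 →
          Larger f (fun i => m' (2 * n + i)) (fun i => m' (3 * n + i)) (J - 1) q →
            f (r' 11) ≤ f q := by
      intro h3 h4
      refine ⟨fun q h5 h6 h7 => ?_, fun q h5 h6 h7 => ?_⟩
      · have : Larger f (fun i => m' (2 * n + i)) (fun i => m' (3 * n + i)) (J - 1) q := by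
          rcases h4 with h | h
          · exact Or.inl h
          · exact Or.inr (by rw [h7]; exact h)
        have := hmin q h5 h6 this
        rw [h7] at this
        exact absurd h3 this.not_gt
      · rcases Nat.lt_or_eq_of_le h6 with h6 | rfl
        · exact h3.le.trans (hmin q h5 h6 h7)
        · exact le_rfl
    have hold : ¬ (f (r' 11) < f (r' 12) ∧
          Larger f (fun i => m' (2 * n + i)) (fun i => m' (3 * n + i)) (J - 1) (r' 11)) →
        ∀ q, start (fun i => m' (2 * n + i)) (J - 1) ≤ q → q ≤ r' 11 →
          Larger f (fun i => m' (2 * n + i)) (fun i => m' (3 * n + i)) (J - 1) q →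
            f (r' 12) ≤ f q := by
      intro h3 q h5 h6 h7
      rcases Nat.lt_or_eq_of_le h6 with h6 | rfl
      · exact hmin q h5 h6 h7
      · exact not_lt.1 fun h => h3 ⟨h, h7⟩
    simp [ld, mov, Consts, h0', h1', h2', h4', h5', h6', h7', e14, e9]
    refine ⟨⟨hqn, hbn⟩, fun h3 => ⟨fun h4 => ?_, fun h4 => ⟨⟨h13 h4, hqn⟩, fun h5 => ?_,
      fun h5 => ?_⟩⟩, fun h3 => ?_⟩
    · obtain ⟨h5, h6⟩ := hnew h3 (hlq.2 (Or.inl h4))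
      exact ⟨by omega, by omega, by omega, ⟨e8, e13, by omega, hqn, by omega,
        hlq.2 (Or.inl h4), h5, hLq, fun q a b => h6 q a (by omega)⟩, by omega⟩
    · obtain ⟨h6, h7⟩ := hnew h3 (hlq.2 (Or.inr h5))
      exact ⟨by omega, by omega, by omega, ⟨e8, e13, by omega, hqn, by omega,
        hlq.2 (Or.inr h5), h6, hLq, fun q a b => h7 q a (by omega)⟩, by omega⟩
    · have h6 := hold fun h => by
        rcases hlq.1 h.2 with h | h
        · exact h4 h
        · exact absurd h h5.not_gt
      exact ⟨by omega, by omega, ⟨e8, e13, by omega, hqn, by omega, hbn, hsb, hlb, hfb, hLb,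
        fun q a b => h6 q a (by omega)⟩, by omega⟩
    · have h6 := hold fun h => absurd h.1 h3.not_gt
      exact ⟨by omega, by omega, ⟨e8, e13, by omega, hqn, by omega, hbn, hsb, hlb, hfb, hLb,
        fun q a b => h6 q a (by omega)⟩, by omega⟩
  · rintro t r' m' ⟨rfl, hc', e8, e9, e14, e13, e10, hle, hn, hbq, hbn, hsb, hlb, hfb, hLb,
      hmin⟩ hc ht
    simp at hc
    refine ⟨rfl, hc', e8, e9, e14, ⟨hsb, hbn, hlb, hfb, by omega, fun q h1 h2 h3 h4 => ?_⟩,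
      by omega⟩
    refine hmin q h1 ?_ h3
    by_contra hcon
    have := HL.mono (r' 11) q (by omega) h2.le
    omega

lemma wp_choose (hM : 8 * n + 8 ≤ M) (hc : Consts n r)
    (H : IsMaxStack f n (fun i => m (2 * n + i)) (fun i => m (3 * n + i)) (fun i => m (4 * n + i))
      ml e)
    (HL : IsTable f n (fun i => m (6 * n + i)) w) (hJ : 0 < r 9) (hJe : r 9 ≤ e + 1)
    (hfound : m (6 * n + m (4 * n + (r 9 - 1))) < r 9) :
    wp f n M choose (fun t r' m' => m' = m ∧ Consts n r' ∧ r' 8 = r 8 ∧ r' 9 = r 9 ∧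
      r' 14 = r 9 - 1 ∧ IsChild f n (fun i => m (2 * n + i)) (fun i => m (3 * n + i))
        (fun i => m (6 * n + i)) (r 9 - 1) (r' 12) ∧ t ≤ 30 * (n + 1)) r m := by
  have hc' := hc
  obtain ⟨h0, h1, h2, h4, h5, h6, h7⟩ := hc'
  have htop := HL.top
  have hen : e ≤ n := (H.stack.le_start e le_rfl).trans (H.stack.start_le_n e le_rfl)
  have hfst := H.firstLarger (k := r 9 - 1) (by omega)
  have hnl := hfst.le
  have hnn : m (4 * n + (r 9 - 1)) < n := by
    refine lt_of_le_of_ne hnl fun h => ?_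
    rw [h] at hfound; omega
  -- the loop, from any state in which register 13 holds the position of the periodic continuation
  simp [choose, ld, mov, h1, h2, h4, h5, h6, h7]
  refine ⟨by omega, by omega, by omega, fun h3 => ⟨by omega, ?_⟩, fun h3 => ?_⟩
  · refine wp_mono (wp_chooseLoop (J := r 9) hM ?_ H HL ?_ hJ hJe ?_ ?_ ?_ ?_ ?_ ?_ ?_)
      fun t r' m' ⟨e1, e2, e3, e4, e5, e6, e7⟩ => ⟨e1, e2, by simpa using e3, e4, e5, e6, by omega⟩
    · simp [Consts, h0, h1, h2, h4, h5, h6, h7]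
    all_goals simp
    · exact hfst
    · exact hnn
    · exact hfound
    · omega
  · have hpp := H.stack.per_pos (r 9 - 1 - 1) (by omega)
    have hpl := H.stack.per_le (r 9 - 1 - 1) (by omega)
    refine ⟨by omega, by omega, by omega, by omega, by omega, ?_⟩
    refine wp_mono (wp_chooseLoop (J := r 9) hM ?_ H HL ?_ hJ hJe ?_ ?_ ?_ ?_ ?_ ?_ ?_)
      fun t r' m' ⟨e1, e2, e3, e4, e5, e6, e7⟩ => ⟨e1, e2, by simpa using e3, e4, e5, e6, by omega⟩
    · simp [Consts, h0, h1, h2, h4, h5, h6, h7]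
    all_goals simp
    · exact hfst
    · exact hnn
    · exact hfound

lemma wp_record (hM : 8 * n + 8 ≤ M) (hc : Consts n r) (hJ : r 9 ≤ n) :
    wp f n M record (fun t r' m' => Consts n r' ∧ r' 9 = r 9 ∧ r' 12 = r 12 ∧
      r' 8 = (if r 8 < r 9 then r 9 else r 8) ∧ (∀ a ≥ n, m' a = m a) ∧
      (∀ i < n, m' i = if r 8 < r 9 ∧ i < r 9 then m (2 * n + i) else m i) ∧
      t ≤ 30 * (n + 1)) r m := by
  have hc' := hc
  obtain ⟨h0, h1, h2, h4, h5, h6, h7⟩ := hc'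
  simp [record, ld, mov, h2]
  refine ⟨fun h3 => ⟨by omega, by omega, ?_⟩, fun h3 => ⟨hc, ?_, ?_, by omega⟩⟩
  · refine wp_loop (fun r' m' => Consts n r' ∧ r' 8 = r 9 ∧ r' 9 = r 9 ∧ r' 12 = r 12 ∧
      r' 14 ≤ r 9 ∧ ∀ a, m' a = if a < r' 14 then m (2 * n + a) else m a)
      (fun r' _ => 10 * (n - r' 14)) ?_ ?_ ?_ ?_
    · simp [Consts, h0, h1, h2, h4, h5, h6, h7]
    · simp
    · rintro r' m' ⟨⟨h0', h1', h2', h4', h5', h6', h7'⟩, e8, e9, e12, hle, hm⟩ hc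
      simp at hc
      simp [Function.update_apply, Consts, h0', h1', h2', h4', h5', h6', h7', e8, e9, e12]
      refine ⟨by omega, by omega, by omega, ⟨by omega, fun a => ?_⟩, by omega⟩
      rw [hm a, hm (2 * n + r' 14)]
      rcases lt_trichotomy a (r' 14) with h | h | h
      · rw [if_neg (by omega), if_pos h, if_pos (by omega)]
      · subst h; rw [if_pos rfl, if_neg (by omega), if_pos (by omega)]
      · rw [if_neg (by omega), if_neg (by omega), if_neg (by omega)]
    · rintro t r' m' ⟨hc', e8, e9, e12, hle, hm⟩ hc ht
      simp at hc
      simp at ht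
      refine ⟨hc', e9, e12, by rw [if_pos h3, e8], fun a ha => ?_, fun i hi => ?_, by omega⟩
      · rw [hm, if_neg (by omega)]
      · rw [hm]
        split_ifs <;> first | rfl | omega
  · intro h; omega
  · intro i hi h; omega

lemma wp_search (hM : 8 * n + 8 ≤ M) (hc : Consts n r) (he : r 14 ≤ n)
    (hr : r 18 = m (4 * n + r 14)) (hnext : ∀ k ≤ r 14, m (4 * n + k) ≤ n)
    (hL : ∀ q ≤ n, m (6 * n + q) ≤ n + 1) :
    wp f n M search (fun t r' m' => m' = m ∧ Consts n r' ∧ r' 8 = r 8 ∧ r' 9 ≤ r 14 + 1 ∧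
      (∀ k, r' 9 ≤ k → k ≤ r 14 → k < m (6 * n + m (4 * n + k))) ∧
      (r' 9 ≠ 0 → m (6 * n + m (4 * n + (r' 9 - 1))) < r' 9) ∧ t ≤ 30 * (n + 2)) r m := by
  have hc' := hc
  obtain ⟨h0, h1, h2, h4, h5, h6, h7⟩ := hc'
  have hn1 := hnext (r 14) le_rfl
  have hL1 := hL _ hn1
  simp [search, ld, h1, h7, hr]
  refine ⟨by omega, by omega, by omega, ?_⟩
  refine wp_loop (fun r' m' => m' = m ∧ Consts n r' ∧ r' 8 = r 8 ∧ r' 9 ≤ r 14 + 1 ∧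
      (∀ k, r' 9 ≤ k → k ≤ r 14 → k < m (6 * n + m (4 * n + k))) ∧
      r' 10 = if r' 9 = 0 then 0 else m (6 * n + m (4 * n + (r' 9 - 1))) + 1)
      (fun r' _ => 12 * r' 9) ?_ ?_ ?_ ?_
  · simp [Consts, h0, h1, h2, h4, h5, h6, h7]
    intro k h3 h4; omega
  · simp
  · rintro r' m' ⟨rfl, ⟨h0', h1', h2', h4', h5', h6', h7'⟩, e8, hle, hall, e10⟩ hc
    simp at hc
    have h9 : r' 9 ≠ 0 := by intro h; rw [if_pos h] at e10; omega
    rw [if_neg h9] at e10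
    have hall' : ∀ k, r' 9 - 1 ≤ k → k ≤ r 14 → k < m' (6 * n + m' (4 * n + k)) := by
      intro k h3 h4
      rcases Nat.lt_or_ge k (r' 9) with h | h
      · obtain rfl : k = r' 9 - 1 := by omega
        omega
      · exact hall k h h4
    simp [Consts, h0', h1', h2', h4', h5', h6', h7', e8]
    refine ⟨by omega, fun h => ⟨by omega, ⟨by omega, fun k h3 h4 => hall' k (by omega) h4, h⟩,
      by omega⟩, fun h => ⟨by omega, ?_⟩⟩
    have hn2 := hnext (r' 9 - 1 - 1) (by omega)
    have hL2 := hL _ hn2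
    refine ⟨by omega, by omega, by omega, ⟨by omega, fun k h3 h4 => hall' k (by omega) h4, ?_⟩,
      by omega⟩
    exact h
  · rintro t r' m' ⟨rfl, hc', e8, hle, hall, e10⟩ hc ht
    simp at hc
    simp at ht
    refine ⟨rfl, hc', e8, hle, hall, fun h => ?_, by omega⟩
    rw [if_neg h] at e10
    omega

lemma wp_extendLoop (hM : 8 * n + 8 ≤ M) (hc : Consts n r)
    (hg : ∀ i < n, IsNextGreater f n i (m (n + i))) {L : ℕ → ℕ} {J : ℕ}
    (hX : IsExtending f n (fun i => m (2 * n + i)) (fun i => m (3 * n + i)) (fun i => m (4 * n + i))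
      L J (r 14) (r 11) (r 18)) (h14 : r 14 = J) (h15 : r 15 = J) (h13 : r 13 = m (2 * n)) :
    wp f n M extendLoop (fun t r' m' => Consts n r' ∧ r' 8 = r 8 ∧
      (∀ a, a < 2 * n ∨ 6 * n ≤ a → m' a = m a) ∧ (∀ i < J, m' (2 * n + i) = m (2 * n + i)) ∧
      IsExtending f n (fun i => m' (2 * n + i)) (fun i => m' (3 * n + i)) (fun i => m' (4 * n + i))
        L J (r' 14) n (r' 18) ∧ t ≤ 50 * n + 1) r m := by
  refine wp_loop (fun r' m' => Consts n r' ∧ r' 8 = r 8 ∧ r' 15 = J ∧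
      r' 13 = m' (2 * n + (r' 14 - J)) ∧
      (∀ a, a < 2 * n ∨ 6 * n ≤ a → m' a = m a) ∧ (∀ i < J, m' (2 * n + i) = m (2 * n + i)) ∧
      IsExtending f n (fun i => m' (2 * n + i)) (fun i => m' (3 * n + i)) (fun i => m' (4 * n + i))
        L J (r' 14) (r' 11) (r' 18)) (fun r' _ => 50 * (n - r' 11)) ?_ ?_ ?_ ?_
  · exact ⟨hc, rfl, h15, by rw [h13, h14]; simp, fun _ _ => rfl, fun _ _ => rfl, hX⟩
  · simp
  · rintro r' m' ⟨⟨h0, h1, h2, h4, h5, h6, h7⟩, e8, e15, e13, hfr, hlow, hX⟩ hc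
    simp [h0] at hc
    have hJ := hX.pos
    have hJk := hX.le
    have hkn : r' 14 ≤ r' 11 := (hX.stack.le_start _ le_rfl).trans hX.start_le
    have hxn : r' 13 < n := by
      rw [e13]; exact hX.stack.lt _ (by omega)
    have hgq := hg _ hc
    rw [← hfr _ (by omega)] at hgq
    simp [ld, mov, st, Function.update_apply, Consts, h0, h1, h2, h4, h5, h6, h7, e15, hxn, hc, e8]
    refine ⟨fun h3 => ⟨fun h8 => ?_, fun h8 => ?_⟩, fun h3 => ⟨fun h8 => ?_, fun h8 =>
      ⟨fun h9 => ?_, fun h9 => ?_⟩⟩⟩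
    · have hX' := hX.found hc (by rw [← e13]; exact h3)
      rw [if_pos h8] at hX'
      exact ⟨by omega, by omega, ⟨e13, hfr, hlow, hX'⟩, by omega⟩
    · have hX' := hX.found hc (by rw [← e13]; exact h3)
      rw [if_neg h8] at hX'
      exact ⟨by omega, ⟨e13, hfr, hlow, hX'⟩, by omega⟩
    · exact ⟨by omega, ⟨e13, hfr, hlow, hX.skip hc (by rw [← e13]; exact h8)⟩, by omega⟩
    · have heq : f (r' 11) = f (r' 13) := le_antisymm h3 h8
      refine ⟨by omega, by omega, by omega, by omega, by omega, by omega, by omega, by omega,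
        by omega, ⟨fun a ha => ?_, fun i hi => ?_, ?_⟩, by omega⟩
      · rw [if_neg (by omega), if_neg (by omega), if_neg (by omega)]; exact hfr a ha
      · rw [if_neg (by omega), if_neg (by omega), if_neg (by omega)]; exact hlow i hi
      · refine hX.push hc (by rw [← e13]; exact heq) hgq ?_ ?_ ?_ ?_ ?_ ?_
        · intro i hi; rw [if_neg (by omega), if_neg (by omega), if_neg (by omega)]
        · intro i hi; rw [if_neg (by omega), if_neg (by omega), if_neg (by omega)]
        · intro i hi; rw [if_neg (by omega), if_neg (by omega), if_neg (by omega)]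
        · rw [if_neg (by omega), if_pos rfl]
        · rw [if_pos rfl]
        · rw [if_neg (by omega), if_neg (by omega), if_pos rfl, if_pos h9]
    · have heq : f (r' 11) = f (r' 13) := le_antisymm h3 h8
      refine ⟨by omega, by omega, by omega, by omega, by omega, by omega, by omega, by omega,
        ⟨fun a ha => ?_, fun i hi => ?_, ?_⟩, by omega⟩
      · rw [if_neg (by omega), if_neg (by omega), if_neg (by omega)]; exact hfr a ha
      · rw [if_neg (by omega), if_neg (by omega), if_neg (by omega)]; exact hlow i hi
      · refine hX.push hc (by rw [← e13]; exact heq) hgq ?_ ?_ ?_ ?_ ?_ ?_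
        · intro i hi; rw [if_neg (by omega), if_neg (by omega), if_neg (by omega)]
        · intro i hi; rw [if_neg (by omega), if_neg (by omega), if_neg (by omega)]
        · intro i hi; rw [if_neg (by omega), if_neg (by omega), if_neg (by omega)]
        · rw [if_neg (by omega), if_pos rfl]
        · rw [if_pos rfl]
        · rw [if_neg (by omega), if_neg (by omega), if_pos rfl, if_neg h9]
  · rintro t r' m' ⟨hc', e8, e15, e13, hfr, hlow, hX⟩ hc ht
    have h0 := hc'.1
    have hn := hX.le_n
    simp [h0] at hc
    obtain hq : r' 11 = n := by omega
    rw [hq] at hX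
    exact ⟨hc', e8, hfr, hlow, hX, by omega⟩

lemma wp_extend (hM : 8 * n + 8 ≤ M) (hc : Consts n r)
    (hg : ∀ i < n, IsNextGreater f n i (m (n + i))) {L : ℕ → ℕ}
    (hX : IsExtending f n (fun i => m (2 * n + i)) (fun i => m (3 * n + i)) (fun i => m (4 * n + i))
      L (r 9) (r 9) (r 12 + 1) n) :
    wp f n M extend (fun t r' m' => Consts n r' ∧ r' 8 = r 8 ∧
      (∀ a, a < 2 * n ∨ 6 * n ≤ a → m' a = m a) ∧ (∀ i < r 9, m' (2 * n + i) = m (2 * n + i)) ∧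
      IsMaxStack f n (fun i => m' (2 * n + i)) (fun i => m' (3 * n + i)) (fun i => m' (4 * n + i))
        (r 9) (r' 14) ∧
      IsSettled f n (fun i => m' (2 * n + i)) (fun i => m' (3 * n + i)) L (r' 14) ∧
      r' 18 = m' (4 * n + r' 14) ∧ t ≤ 60 * (n + 1)) r m := by
  have hc' := hc
  obtain ⟨h0, h1, h2, h4, h5, h6, h7⟩ := hc'
  have h9 : r 9 ≤ n := (hX.stack.le_start _ le_rfl).trans (hX.start_le.trans hX.le_n)
  have h12 := hX.le_n
  simp [extend, ld, mov, st, h0, h1, h2, h4]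
  refine ⟨by omega, by omega, by omega, by omega, ?_⟩
  refine wp_mono (wp_extendLoop (J := r 9) hM ?_ hg (L := L) ?_ ?_ ?_ ?_) ?_
  · simp [Consts, h0, h1, h2, h4, h5, h6, h7]
  · simpa using hX
  · simp
  · simp
  · simp
  · rintro t r' m' ⟨⟨h0', h1', h2', h4', h5', h6', h7'⟩, e8, hfr, hlow, hX', ht⟩
    simp at e8
    have hle := (hX'.stack.le_start _ le_rfl).trans (hX'.start_le.trans hX'.le_n)
    have hset := hX'.settled
    have hfr1 : ∀ i < r' 14, (if 2 * n + i = 4 * n + r' 14 then r' 18 else m' (2 * n + i)) =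
        m' (2 * n + i) := fun i hi => if_neg (by omega)
    have hfr2 : ∀ i < r' 14, (if 3 * n + i = 4 * n + r' 14 then r' 18 else m' (3 * n + i)) =
        m' (3 * n + i) := fun i hi => if_neg (by omega)
    simp [Function.update_apply, Consts, h0', h1', h2', h4', h5', h6', h7', e8]
    refine ⟨by omega, fun a ha => ?_, fun i hi => ?_, ?_, ?_, by omega⟩
    · rw [if_neg (by omega)]; exact hfr a ha
    · rw [if_neg (by omega)]; exact hlow i hi
    · exact hX'.isMaxStack hfr1 hfr2 (fun i hi => if_neg (by omega)) (if_pos rfl)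
    · exact hset.congr hX'.stack.per_pos hfr1 hfr2 hX'.stack.lt fun _ _ => le_rfl

lemma wp_greaterLoop (hM : 8 * n + 8 ≤ M) (hc : Consts n r) (hi : r 11 < n) (h14 : r 14 = n)
    (h17 : r 17 = r 11 + 1) (h18 : r 18 = n) :
    wp f n M greaterLoop (fun t r' m' => m' = m ∧ Consts n r' ∧ r' 8 = r 8 ∧ r' 11 = r 11 ∧
      IsNextGreater f n (r 11) (r' 18) ∧ t ≤ 10 * n + 1) r m := by
  refine wp_loop (fun r' m' => m' = m ∧ Consts n r' ∧ r' 8 = r 8 ∧ r' 11 = r 11 ∧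
      r' 17 = r 11 + 1 ∧ r 11 < r' 14 ∧ r' 14 ≤ n ∧ r' 14 ≤ r' 18 ∧ r' 18 ≤ n ∧
      (r' 18 < n → f (r 11) < f (r' 18)) ∧
      (∀ q, r' 14 ≤ q → q < r' 18 → ¬ f (r 11) < f q)) (fun r' _ => 10 * r' 14) ?_ ?_ ?_ ?_
  · exact ⟨rfl, hc, rfl, rfl, h17, by omega, by omega, by omega, by omega, fun h => by omega,
      fun q h1 h2 => by omega⟩
  · simp
  · rintro r' m' ⟨rfl, ⟨h0, h1, h2, h4, h5, h6, h7⟩, e8, e11, e17, hlt, hle, h1418, h18n, hgt,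
      hng⟩ hc
    simp at hc
    simp [mov, Consts, h0, h1, h2, h4, h5, h6, h7, e8, e11, e17]
    refine ⟨by omega, ⟨hi, by omega⟩, fun h => ⟨by omega, ⟨by omega, by omega, fun _ => h,
      fun q h3 h4 => by omega⟩, by omega⟩,
      fun h => ⟨⟨by omega, by omega, by omega, h18n, hgt, fun q h1 h2 => ?_⟩, by omega⟩⟩
    rcases Nat.lt_or_ge q (r' 14) with h3 | h3
    · obtain rfl : q = r' 14 - 1 := by omega
      exact h
    · exact not_lt.1 (hng q h3 h2)
  · rintro t r' m' ⟨rfl, hc', e8, e11, e17, hlt, hle, h1418, h18n, hgt, hng⟩ hc ht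
    simp at hc
    exact ⟨rfl, hc', e8, e11, ⟨by omega, h18n, hgt, fun q h1 h2 => hng q (by omega) h2⟩, by omega⟩

lemma wp_greater (hM : 8 * n + 8 ≤ M) (hc : Consts n r) (h11 : r 11 = 0) :
    wp f n M greater (fun t r' m' => Consts n r' ∧ r' 8 = r 8 ∧
      (∀ i < n, IsNextGreater f n i (m' (n + i))) ∧
      (∀ a, a < n ∨ 2 * n ≤ a → m' a = m a) ∧ t ≤ n * (40 * (n + 1)) + 1) r m := by
  refine wp_loop (fun r' m' => Consts n r' ∧ r' 8 = r 8 ∧ r' 11 ≤ n ∧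
      (∀ i < r' 11, IsNextGreater f n i (m' (n + i))) ∧
      (∀ a, a < n ∨ 2 * n ≤ a → m' a = m a)) (fun r' _ => (n - r' 11) * (40 * (n + 1))) ?_ ?_ ?_ ?_
  · exact ⟨hc, rfl, by omega, fun i hi => by omega, fun _ _ => rfl⟩
  · simp
  · rintro r' m' ⟨hcs, e8, hle, hg, hfr⟩ hc
    have hcs' := hcs
    obtain ⟨h0, h1, h2, h4, h5, h6, h7⟩ := hcs'
    simp [h0] at hc
    simp [mov, st, h0, h1, h2]
    refine ⟨by omega, by omega, ?_⟩
    refine wp_mono (wp_greaterLoop hM ?_ (by simpa using hc) (by simp) (by simp) (by simp)) ?_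
    · simp [Consts, h0, h1, h2, h4, h5, h6, h7]
    · rintro t r'' m'' ⟨rfl, ⟨h0', h1', h2', h4', h5', h6', h7'⟩, e8', e11, hng, ht⟩
      simp at e8' e11 hng
      simp [Function.update_apply, Consts, h0', h1', h2', h4', h5', h6', h7', e8', e11]
      refine ⟨by omega, by omega, ⟨e8, hc, fun i hi => ?_, fun a ha => ?_⟩, ?_⟩
      · split_ifs with h
        · subst h; exact hng
        · exact hg i (by omega)
      · rw [if_neg (by omega)]; exact hfr a ha
      · obtain ⟨k, hk⟩ : ∃ k, n - r' 11 = k + 1 := ⟨n - r' 11 - 1, by omega⟩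
        rw [hk, show n - (r' 11 + 1) = k by omega, Nat.add_mul]
        omega
  · rintro t r' m' ⟨hcs, e8, hle, hg, hfr⟩ hc ht
    simp [hcs.1] at hc
    refine ⟨hcs, e8, fun i hi => hg i (by omega), hfr, ?_⟩
    simp [h11] at ht
    omega

lemma wp_init (hM : 8 * n + 8 ≤ M) (h0 : r 0 = n) (h : ∀ i ≠ 0, r i = 0) :
    wp f n M init (fun t r' m' => Consts n r' ∧ r' 8 = 0 ∧ r' 9 = 1 ∧
      (∀ i < n, IsNextGreater f n i (m' (n + i))) ∧ m' (7 * n) = n + 1 ∧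
      (∀ a, 2 * n ≤ a → a ≠ 7 * n → m' a = m a) ∧ t ≤ n * (40 * (n + 1)) + 20) r m := by
  simp [init, st, h0]
  refine ⟨by omega, by omega, by omega, by omega, by omega, by omega, by omega, ?_⟩
  refine wp_mono (wp_greater hM ?_ ?_) ?_
  · simp [Consts, h0, h 2]; omega
  · simp [h 11]
  · rintro t r' m' ⟨⟨h0', h1', h2', h4', h5', h6', h7'⟩, e8, hg, hfr, ht⟩
    simp [h 8] at e8
    simp [Consts, h0', h1', h2', h4', h5', h6', h7', e8]
    refine ⟨by omega, hg, ?_, fun a ha hne => ?_, by omega⟩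
    · rw [hfr _ (by omega), show n + n + (n + n) + (n + n) + n = 7 * n by omega]; simp
    · rw [hfr a (by omega), Function.update_of_ne (by omega)]

/-- The invariant of the main loop: the current word has length `ml` and its stack length `e`, and
register 9 holds the number of symbols of the next word. -/
structure IsState (f : ℕ → α) (n : ℕ) (r m : ℕ → ℕ) (ml e : ℕ) : Prop where
  consts : Consts n r
  greater : ∀ i < n, IsNextGreater f n i (m (n + i))
  stack : IsMaxStack f n (fun i => m (2 * n + i)) (fun i => m (3 * n + i)) (fun i => m (4 * n + i))
    ml e
  settled : IsSettled f n (fun i => m (2 * n + i)) (fun i => m (3 * n + i))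
    (fun i => m (6 * n + i)) e
  table : IsTable f n (fun i => m (6 * n + i)) (word (fun i => f (m (2 * n + i))) ml)
  best : IsBest (word f n) (word (fun i => f (m i)) (r 8)) (word (fun i => f (m (2 * n + i))) ml)
  out_lt : ∀ i < r 8, m i < n
  out_mono : ∀ i j, i < j → j < r 8 → m i < m j
  le : r 9 ≤ e + 1
  pruned : ∀ k, r 9 ≤ k → k ≤ e → k < m (6 * n + m (4 * n + k))
  candidate : r 9 ≠ 0 → m (6 * n + m (4 * n + (r 9 - 1))) < r 9

/-- The amount by which the table of pruning lengths can still grow, which bounds the number of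
rounds to come. -/
def slack (n : ℕ) (m : ℕ → ℕ) : ℕ := ∑ q ∈ Finset.range n, (n - m (6 * n + q))

lemma wp_round (hM : 8 * n + 8 ≤ M) (hS : IsState f n r m ml e) (hJ : 0 < r 9) :
    wp f n M round (fun t r' m' => (∃ ml' e', IsState f n r' m' ml' e') ∧
      t + 1 + 200 * (n + 2) * slack n m' ≤ 200 * (n + 2) * slack n m) r m := by
  simp only [round, wp_seq]
  refine wp_mono (wp_choose hM hS.consts hS.stack hS.table hJ hS.le (hS.candidate (by omega))) ?_
  rintro t₁ r₁ m₁ ⟨rfl, hc₁, e8₁, e9₁, e14₁, hb, ht₁⟩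
  obtain ⟨j, hj⟩ : ∃ j, r 9 = j + 1 := ⟨r 9 - 1, by omega⟩
  rw [hj, Nat.add_sub_cancel] at e14₁ hb
  rw [hj] at e9₁
  generalize hbr : r₁ 12 = b at hb
  have hje : j ≤ e := by have := hS.le; omega
  have hbn := hb.lt
  have hjn : j < n := by
    have h1 := hS.stack.stack.le_start j hje
    have h2 := hb.start_le
    omega
  refine wp_mono (wp_settle hM hc₁ hS.table (by omega) (by omega) (by omega)) ?_
  rintro t₂ r₂ m₂ ⟨hc₂, e8₂, e9₂, e12₂, hlow, htab, ht₂⟩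
  simp only [hbr, e14₁, e9₁] at hlow htab e12₂ e9₂
  have hP : ∀ i < j, m₂ (2 * n + i) = m₁ (2 * n + i) := fun i hi => by
    rw [hlow _ (by omega), if_neg (by omega), if_neg (by omega)]
  have hper : ∀ i < j, m₂ (3 * n + i) = m₁ (3 * n + i) := fun i hi => by
    rw [hlow _ (by omega), if_neg (by omega), if_neg (by omega)]
  have hnext : ∀ i ≤ j, m₂ (4 * n + i) = m₁ (4 * n + i) := fun i hi => by
    rw [hlow _ (by omega), if_neg (by omega), if_neg (by omega)]
  have hPj : m₂ (2 * n + j) = b := by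
    rw [hlow _ (by omega), if_neg (by omega), if_pos rfl]
  have hperj : m₂ (3 * n + j) = j + 1 := by rw [hlow _ (by omega), if_pos rfl]
  have hL : ∀ q < n, m₁ (6 * n + q) ≤ m₂ (6 * n + q) := fun q hq => by
    rw [htab q hq.le]; split_ifs <;> omega
  have hbt : m₁ (6 * n + b) ≤ j := hb.table
  have hLb : m₂ (6 * n + b) = j + 1 := by
    rw [htab b hbn.le, if_pos ⟨le_rfl, by omega⟩]
  have hst₂ := hS.stack.child_stack hje hb (P' := fun i => m₂ (2 * n + i))
    (per' := fun i => m₂ (3 * n + i)) (next' := fun i => m₂ (4 * n + i)) hP hper hnext hPj hperj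
  have hset₂ := hS.settled.child hS.stack hje hb (P' := fun i => m₂ (2 * n + i))
    (per' := fun i => m₂ (3 * n + i)) (L' := fun i => m₂ (6 * n + i)) hP hper hPj hL
    (by simp only [hLb]; omega)
  have hlt := hS.stack.lt_child hS.settled hje hb (g := fun i => f (m₂ (2 * n + i)))
    (fun i hi => by simp only [hP i hi]) (by simp only [hPj])
  have hly : IsLyndon (word (fun i => f (m₂ (2 * n + i))) (j + 1)) := by
    rw [isLyndon_word]
    have := hst₂.lyndon j (by omega)
    rwa [hperj] at this
  have hsub := hst₂.sublist (j + 1) le_rfl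
  simp only [start, hPj] at hsub
  have htable₂ : IsTable f n (fun i => m₂ (6 * n + i))
      (word (fun i => f (m₂ (2 * n + i))) (j + 1)) := by
    refine hS.table.update hlt.le hly (b := b) (by simpa using hjn) hsub ?_ ?_
    · intro q hq; simpa using htab q hq.le
    · have htop := hS.table.top
      have := htab n le_rfl
      rw [if_neg (by omega)] at this
      simp only [this, htop]
  have hdom : ∀ v, IsLyndon v → v.Sublist (word f n) →
      v < word (fun i => f (m₂ (2 * n + i))) (j + 1) →
      Dominates (word (fun i => f (m₁ i)) (r 8)) v := by
    intro v h1 h2 h3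
    refine hS.stack.dominates hS.table hS.best (J := j + 1) (b := b)
      (fun k h4 h5 => hS.pruned k (by omega) h5) (by omega) (fun _ => hb) h1 h2 fun _ => ?_
    have : word (fun i => f (m₂ (2 * n + i))) (j + 1) =
        word (fun i => f (m₁ (2 * n + i))) j ++ [f b] := by
      rw [word_congr (k := j) (h := fun i => f (m₂ (2 * n + i)))
        (fun i hi => by simp only [hP i hi])]
      simp [word, List.range_succ, hPj]
    rw [this] at h3
    exact h3
  have hbest₂ := hS.best.update hlt hly (hsub.trans (List.take_sublist _ _)) hdom
  refine wp_mono (wp_record hM hc₂ (by omega)) ?_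
  rintro t₃ r₃ m₃ ⟨hc₃, e9₃, e12₃, e8₃, hfr, hout, ht₃⟩
  rw [e8₂, e8₁, e9₂] at e8₃ hout
  rw [e9₂] at e9₃
  rw [e12₂] at e12₃
  have hP₃ : (fun i => m₃ (2 * n + i)) = fun i => m₂ (2 * n + i) :=
    funext fun i => hfr _ (by omega)
  have hper₃ : (fun i => m₃ (3 * n + i)) = fun i => m₂ (3 * n + i) :=
    funext fun i => hfr _ (by omega)
  have hnext₃ : (fun i => m₃ (4 * n + i)) = fun i => m₂ (4 * n + i) :=
    funext fun i => hfr _ (by omega)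
  have hg₃ : ∀ i < n, IsNextGreater f n i (m₃ (n + i)) := fun i hi => by
    rw [hfr _ (by omega), hlow _ (by omega), if_neg (by omega), if_neg (by omega)]
    exact hS.greater i hi
  have hX : IsExtending f n (fun i => m₃ (2 * n + i)) (fun i => m₃ (3 * n + i))
      (fun i => m₃ (4 * n + i)) (fun i => m₂ (6 * n + i)) (r₃ 9) (r₃ 9) (r₃ 12 + 1) n := by
    rw [hP₃, hper₃, hnext₃, e9₃, e12₃]
    refine ⟨hst₂, hset₂, by omega, le_rfl, fun i hi h1 => ?_, ?_, hbn, fun i h1 h2 => ?_,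
      Or.inl ⟨rfl, fun i h1 h2 => ?_⟩⟩
    · obtain rfl : i = j := by omega
      exact hperj
    · simp [start, hPj]
    · simp only [start, hPj] at h1; omega
    · simp only [start, hPj] at h1; omega
  refine wp_mono (wp_extend hM hc₃ hg₃ hX) ?_
  rintro t₄ r₄ m₄ ⟨hc₄, e8₄, hfr₄, hlow₄, hmax, hset₄, e18₄, ht₄⟩
  rw [e9₃] at hlow₄ hmax
  have hL₄ : ∀ q, m₄ (6 * n + q) = m₂ (6 * n + q) := fun q => by
    rw [hfr₄ _ (by omega), hfr _ (by omega)]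
  have hw₄ : word (fun i => f (m₄ (2 * n + i))) (j + 1) =
      word (fun i => f (m₂ (2 * n + i))) (j + 1) :=
    word_congr fun i hi => by simp only [hlow₄ i hi, hfr (2 * n + i) (by omega)]
  have he₄ : r₄ 14 ≤ n := (hmax.stack.le_start _ le_rfl).trans (hmax.stack.start_le_n _ le_rfl)
  refine wp_mono (wp_search hM hc₄ he₄ e18₄ (fun k hk => (hmax.firstLarger hk).le) ?_) ?_
  · intro q hq
    rw [hL₄]
    have htop : m₂ (6 * n + n) = n + 1 := htable₂.top
    have := htable₂.mono q n hq le_rfl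
    simp only [htop] at this
    exact this
  rintro t₅ r₅ m₅ ⟨rfl, hc₅, e8₅, hle, hpr, hcand, ht₅⟩
  have hout₅ : ∀ i < n, m₅ i = if r 8 < j + 1 ∧ i < j + 1 then m₂ (2 * n + i) else m₁ i := by
    intro i hi
    rw [hfr₄ _ (by omega), hout i hi]
    split_ifs
    · rfl
    · rw [hlow i (by omega), if_neg (by omega), if_neg (by omega)]
  have e8 : r₅ 8 = if r 8 < j + 1 then j + 1 else r 8 := by rw [e8₅, e8₄, e8₃]
  -- the output array is not longer than the input
  have h8n : r 8 ≤ n := by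
    rcases hS.best.eq_nil_or with h | h
    · have := congrArg List.length h
      simp at this; omega
    · simpa using h.2.length_le
  have hBw : word (fun i => f (m₅ i)) (r₅ 8) =
      if (word (fun i => f (m₁ i)) (r 8)).length <
        (word (fun i => f (m₂ (2 * n + i))) (j + 1)).length
      then word (fun i => f (m₂ (2 * n + i))) (j + 1) else word (fun i => f (m₁ i)) (r 8) := by
    simp only [length_word, e8]
    split_ifs with h
    · exact word_congr fun i hi => by simp only [hout₅ i (by omega), h, hi, and_self, if_true]
    · exact word_congr fun i hi => by simp only [hout₅ i (by omega), h, false_and, if_false]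
  refine ⟨⟨j + 1, r₄ 14, hc₅, fun i hi => ?_, hmax, ?_, ?_, ?_, ?_, ?_, hle, hpr, hcand⟩, ?_⟩
  · rw [hfr₄ _ (by omega)]; exact hg₃ i hi
  · simpa only [hL₄] using hset₄
  · rw [hw₄]; simpa only [hL₄] using htable₂
  · rw [hw₄, hBw]; exact hbest₂
  · intro i hi
    rw [e8] at hi
    split_ifs at hi with h
    · rw [hout₅ i (by omega), if_pos ⟨h, hi⟩]; exact hst₂.lt i hi
    · rw [hout₅ i (by omega), if_neg (by omega)]; exact hS.out_lt i hi
  · intro i k hik hk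
    rw [e8] at hk
    split_ifs at hk with h
    · rw [hout₅ i (by omega), if_pos ⟨h, by omega⟩, hout₅ k (by omega), if_pos ⟨h, by omega⟩]
      exact hst₂.pos_lt hik hk
    · rw [hout₅ i (by omega), if_neg (by omega), hout₅ k (by omega), if_neg (by omega)]
      exact hS.out_mono i k hik hk
  · -- the table entry at the new position has grown, which pays for the round
    have hslack : slack n m₅ + 1 ≤ slack n m₁ := by
      unfold slack
      refine Nat.succ_le_of_lt (Finset.sum_lt_sum (fun q hq => ?_) ⟨b, Finset.mem_range.2 hbn, ?_⟩)
      · have := hL q (Finset.mem_range.1 hq)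
        rw [hL₄]; omega
      · rw [hL₄, hLb]; omega
    calc _ ≤ 200 * (n + 2) * (slack n m₅ + 1) := by
            rw [Nat.mul_succ (200 * (n + 2))]; omega
      _ ≤ _ := Nat.mul_le_mul_left _ hslack

lemma wp_lyndonProg (hn : 0 < n) (hM : 8 * n + 8 ≤ M) (h0 : r 0 = n) (h : ∀ i ≠ 0, r i = 0)
    (hm : ∀ i, m i = 0) :
    wp f n M lyndonProg (fun t r' m' => t ≤ 1000 * n ^ 3 ∧ (∀ i < r' 0, m' i < n) ∧
      (∀ i j, i < j → j < r' 0 → m' i < m' j) ∧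
      IsLeastLongestLyndonSubseq (word f n) (word (fun i => f (m' i)) (r' 0))) r m := by
  simp only [lyndonProg, wp_seq]
  refine wp_mono (wp_init hM h0 h) ?_
  rintro t₁ r₁ m₁ ⟨hc₁, e8, e9, hg, htop, hz, ht₁⟩
  have hslack : slack n m₁ ≤ n * n := by
    calc _ ≤ ∑ q ∈ Finset.range n, n := Finset.sum_le_sum fun q _ => Nat.sub_le _ _
      _ = n * n := by simp
  have hz' : ∀ a, 2 * n ≤ a → a ≠ 7 * n → m₁ a = 0 := fun a h1 h2 => by rw [hz a h1 h2, hm]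
  have htop' : m₁ (6 * n + n) = n + 1 := by rw [← htop]; congr 1; omega
  refine wp_loop (fun r' m' => ∃ ml e, IsState f n r' m' ml e)
    (fun _ m' => 200 * (n + 2) * slack n m') ?_ ?_ ?_ ?_
  · refine ⟨0, 0, hc₁, hg, ⟨IsStack.empty, ?_, le_rfl, Or.inr rfl, ?_, ?_⟩, ?_, ?_, ?_, ?_, ?_,
      ?_, ?_, ?_⟩
    · simp only [hz' (4 * n + 0) (by omega) (by omega)]
      exact ⟨le_rfl, by omega, fun _ => Or.inl rfl, fun i h1 h2 => by omega⟩
    · intro i hi; omega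
    · intro h; omega
    · intro i hi; omega
    · refine ⟨fun q q' h1 h2 => ?_, htop', fun q hq => ?_, fun q hq hne => ?_⟩
      · rcases Nat.lt_or_eq_of_le (h1.trans h2) with h3 | rfl
        · simp only [hz' (6 * n + q) (by omega) (by omega)]; omega
        · obtain rfl : q = q' := by omega
          exact le_rfl
      · simp only [hz' (6 * n + q) (by omega) (by omega)]; omega
      · exact absurd (hz' (6 * n + q) (by omega) (by omega)) hne
    · rw [e8]
      refine ⟨Or.inl rfl, le_rfl, fun v h1 h2 h3 => ?_⟩
      rcases v with _ | ⟨c, v⟩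
      · exact absurd rfl h1.1
      · exact absurd (List.nil_lt_cons c v) (not_lt_of_ge h3)
    · intro i hi; omega
    · intro i j hi hj; omega
    · omega
    · intro k h1 h2; omega
    · intro _
      simp only [e9, Nat.sub_self, hz' (4 * n + 0) (by omega) (by omega),
        hz' (6 * n + 0) (by omega) (by omega)]
      omega
  · simp
  · rintro r' m' ⟨ml, e, hS⟩ hc
    simp [hS.consts.2.2.1] at hc
    exact wp_round hM hS hc
  · rintro t r' m' ⟨ml, e, hS⟩ hc ht
    simp [hS.consts.2.2.1] at hc
    have h8n : r' 8 ≤ n := by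
      rcases hS.best.eq_nil_or with h | h
      · have := congrArg List.length h
        simp at this; omega
      · simpa using h.2.length_le
    simp [mov, hS.consts.2.2.1]
    refine ⟨by omega, ?_, hS.out_lt, hS.out_mono, ?_⟩
    · have h1 : 200 * (n + 2) * slack n m₁ ≤ 200 * (n + 2) * (n * n) := Nat.mul_le_mul_left _ hslack
      have h2 : n ≤ n ^ 2 := Nat.le_self_pow (by omega) n
      have h3 : n ^ 2 ≤ n ^ 3 := Nat.pow_le_pow_right hn (by omega)
      nlinarith
    · refine hS.best.isLeast ?_ ?_
      · intro h
        have := congrArg List.length h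
        simp at this; omega
      · intro v h1 h2
        exact hS.stack.dominates hS.table hS.best (J := 0) (b := 0)
          (fun k _ h4 => hS.pruned k (by omega) h4) (by omega) (fun h => absurd rfl h) h1 h2
          (fun h => absurd rfl h)

end Spec

end WordRAM

theorem mainTheorem1 :
    ∃ (P : WordRAM.Prog) (C : ℕ),
      ∀ (α : Type*) [LinearOrder α] (T : List α), T ≠ [] →
      ∀ w : ℕ, C * T.length ≤ 2 ^ w →
        ∃ (t : ℕ) (s : WordRAM.State w),
          WordRAM.Exec T (C * T.length) P (WordRAM.State.init w T.length) t s ∧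
          t ≤ C * T.length ^ 3 ∧
          ∃ S : List α, Spells T s.output S ∧ IsLeastLongestLyndonSubseq T S := by
  refine ⟨WordRAM.lyndonProg, 1000, fun α _ T hT w hw => ?_⟩
  have hn := List.length_pos_of_ne_nil hT
  obtain ⟨f, hf⟩ := exists_word (T.head hT) T
  generalize T.length = n at hf hn hw ⊢
  subst hf
  have hnw : n < 2 ^ w := by omega
  have hinit : (WordRAM.State.init w n).Holds
      (fun i => if i = 0 then n else 0) (fun _ => 0) := by
    refine ⟨fun i => ?_, fun i => by simp [WordRAM.State.init]⟩
    by_cases hi : i = 0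
    · subst hi; simp [WordRAM.State.init, Nat.mod_eq_of_lt hnw]
    · simp [WordRAM.State.init, hi]
  obtain ⟨t, s, r, m, hexec, hs, ht, hlt, hmono, hbest⟩ :=
    WordRAM.wp_sound hw (WordRAM.wp_lyndonProg (f := f) (M := 1000 * n)
      (r := fun i => if i = 0 then n else 0) (m := fun _ => 0) hn (by omega) (if_pos rfl)
      (fun i hi => if_neg hi) (fun _ => rfl)) hinit
  refine ⟨t, s, hexec, ht, _, ?_, hbest⟩
  have hout : s.output = (List.range (r 0)).map m := by
    simp only [WordRAM.State.output, hs.1, hs.2]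
  rw [hout]
  refine ⟨?_, ?_⟩
  · rw [List.pairwise_map]
    refine List.Pairwise.imp_of_mem (R := (· < ·)) ?_ List.pairwise_lt_range
    intro a b _ hb hab
    exact hmono a b hab (List.mem_range.1 hb)
  · simp only [word, List.map_map]
    refine List.map_congr_left fun i hi => ?_
    simp [hlt i (List.mem_range.1 hi)]
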